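/- Let $T$ be a complete first-order theory in a (one-sorted) language $L$, and let $\mathbb{M}\models T$ be a monster model: for some cardinal $\kappa>|L|+\aleph_0$, $\mathbb{M}$ is $\kappa$-saturated and strongly $\kappa$-homogeneous. *Small* means of cardinality less than $\kappa$; $M$ ranges over small elementary substructures of $\mathbb{M}$, and tuples from $\mathbb M$ (finite or infinite) are small. For small $A,B,C\subseteq\mathbb{M}$: - $A\perp^{i}_{C}B$ means that $\operatorname{tp}(A/BC)$ extends to a global type $p\in S(\mathbb{M})$ that is Lascar-invariant over $C$, i.e. for every $L$-formula $\varphi(x;y)$ with $y$ a finite tuple and all tuples $d,e$ from $\mathbb{M}$ with the same Lascar strong type over $C$, $\varphi(x;d)\in p\iff\varphi(x;e)\in p$. Here $d,e$ have the same Lascar strong type over $C$ if they are joined by a finite chain $d=d_0,\dots,d_n=e$ such that, for each $k<n$, $d_k$ and $d_{k+1}$ have the same type over some small elementary substructure of $\mathbb{M}$ containing $C$. - $A\perp^{u}_{C}B$ means that $\operatorname{tp}(A/BC)$ is finitely satisfiable in $C$. - $A\perp^{ci}_{C}B$ means $B\perp^{i}_{C}A$, and $A\perp^{h}_{C}B$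 means $B\perp^{u}_{C}A$. A ternary relation $\perp$ on small subsets of $\mathbb{M}$ satisfies *weak independent amalgamation over models* if, for every $M$ and all small tuples $b_0,b_1,c_0,c_1$ with $b_0c_0\equiv_M b_1c_1$, $b_j\perp_M c_j$ for $j=0,1$, and $c_0\perp_M c_1$, there is $b$ in $\mathbb{M}$ with $bc_0\equiv_M bc_1\equiv_M b_0c_0$. An $L$-formula $\varphi(x;y)$ ($x$, $y$ finite tuples) exemplifies $\mathrm{SOP}_1$ modulo $T$ if in some model of $T$ there are tuples $(a_\eta)_{\eta\in2^{<\omega}}$ such that (a) for every $\eta\in2^{\omega}$ the set $\{\varphi(x;a_{\eta|n}):n<\omega\}$ is consistent, and (b) whenever $\eta\frown0\trianglelefteq\nu\in2^{<\omega}$, the set $\{\varphi(x;a_{\eta\frown1}),\varphi(x;a_\nu)\}$ is inconsistent. $T$ is $\mathrm{NSOP}_1$ if no formula exemplifies $\mathrm{SOP}_1$ modulo $T$. **Theorem.** The following are equivalent: 1. $\perp^{ci}$ satisfies weak independent amalgamation over models; that is, whenever $b_0c_0\equiv_M b_1c_1$, $c_1\perp^{i}_M c_0$ and $c_j\perp^{i}_M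 b_j$ for $j=0,1$, there is $b$ with $bc_0\equiv_M bc_1\equiv_M b_0c_0$. 2. $\perp^{h}$ satisfies weak independent amalgamation over models; that is, whenever $b_0c_0\equiv_M b_1c_1$, $c_1\perp^{u}_M c_0$ and $c_j\perp^{u}_M b_j$ for $j=0,1$, there is $b$ with $bc_0\equiv_M bc_1\equiv_M b_0c_0$. 3. $T$ is $\mathrm{NSOP}_1$. -/

import Mathlib

open FirstOrder FirstOrder.Language Cardinal

universe u v w w'

namespace ModelTheoreticIndependence

section Types

variable (L : FirstOrder.Language.{u, v}) {N : Type w} [L.Structure N]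

/-- `a ≡_A b`: the tuples `a` and `b` satisfy the same formulas with parameters in `A`,
i.e. `tp(a/A) = tp(b/A)`. -/
def TypeEq (A : Set N) {ι : Type w'} (a b : ι → N) : Prop :=
  ∀ ψ : L[[A]].Formula ι, ψ.Realize a ↔ ψ.Realize b

/-- `N` is `κ`-saturated: every finitely satisfiable set of formulas in one variable, with
parameters from a set of size less than `κ`, is realized in `N`. -/
def IsSaturated (N : Type w) [L.Structure N] (κ : Cardinal.{w}) : Prop :=
  ∀ A : Set N, #A < κ → ∀ Γ : Set (L[[A]].Formula Unit),
    (∀ Δ : Finset (L[[A]].Formula Unit), (Δ : Set (L[[A]].Formula Unit)) ⊆ Γ →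
      ∃ x : N, ∀ ψ ∈ Δ, ψ.Realize (fun _ => x)) →
    ∃ x : N, ∀ ψ ∈ Γ, ψ.Realize (fun _ => x)

/-- `N` is strongly `κ`-homogeneous: every partial elementary map with domain of size less
than `κ` extends to an automorphism. -/
def IsStronglyHomogeneous (N : Type w) [L.Structure N] (κ : Cardinal.{w}) : Prop :=
  ∀ (A : Set N) (f : A → N), #A < κ →
    (∀ φ : L.Formula A, φ.Realize (fun x : A => (x : N)) ↔ φ.Realize f) →
    ∃ σ : N ≃[L] N, ∀ x : A, σ (x : N) = f x

/-- `N` is a monster model with respect to `κ`; the sets and tuples of size less than `κ` are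
the small ones. The cardinal `κ` is larger than the number of formulas of the language. -/
structure IsMonster (N : Type w) [L.Structure N] (κ : Cardinal.{w}) : Prop where
  aleph0_lt : ℵ₀ < κ
  card_lt : Cardinal.lift.{w} L.card < Cardinal.lift.{max u v} κ
  saturated : IsSaturated L N κ
  homogeneous : IsStronglyHomogeneous L N κ

variable {L}

/-- The formula `φ(x; a)` with parameters `a` obtained from `φ(x; y)` by substituting the
tuple `a` of elements of `N` for `y`. -/
noncomputable def inst {ι κ : Type*} (φ : L.Formula (ι ⊕ κ)) (a : κ → N) : L[[N]].Formula ι :=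
  BoundedFormula.constantsVarsEquiv.symm
    (Formula.relabel (Sum.elim Sum.inr (fun j => Sum.inl (a j))) φ : L.Formula (N ⊕ ι))

theorem realize_inst {ι κ : Type*} (φ : L.Formula (ι ⊕ κ)) (a : κ → N) (x : ι → N) :
    (inst φ a).Realize x ↔ φ.Realize (Sum.elim x a) := by
  have h := BoundedFormula.realize_constantsVarsEquiv (L := L) (M := N) (φ := inst φ a) (v := x)
    (xs := default)
  rw [inst, Equiv.apply_symm_apply] at h
  refine h.symm.trans ((Formula.realize_relabel (φ := φ)).trans ?_)
  have : Sum.elim (fun b : N => ((L.con b : L[[N]].Constants) : N)) x ∘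
      Sum.elim Sum.inr (fun j => Sum.inl (a j)) = Sum.elim x a := by
    funext i
    rcases i with i | j
    · rfl
    · rfl
  rw [this]

variable (L N)

/-- Complete types over the whole structure `N` in the variables `ι`. -/
abbrev GlobalType (ι : Type w') := (L.elementaryDiagram N).CompleteType ι

variable {L N}

/-- The global type `p(x)` extends `tp(a/A)`. -/
def GlobalType.Extends {ι : Type w'} (p : GlobalType L N ι) (A : Set N) (a : ι → N) : Prop :=
  ∀ (n : ℕ) (φ : L.Formula (ι ⊕ Fin n)) (d : Fin n → N), (∀ i, d i ∈ A) →
    φ.Realize (Sum.elim a d) → Formula.equivSentence (inst φ d) ∈ p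

variable (L) in
/-- The tuples `a` and `b` have the same Lascar strong type over `C`: they are joined by a
finite chain of tuples in which consecutive members have the same type over some small
elementary substructure containing `C`. -/
def LascarEq (κ : Cardinal.{w}) (C : Set N) {ι : Type w'} (a b : ι → N) : Prop :=
  Relation.ReflTransGen
    (fun d e : ι → N => ∃ S : L.ElementarySubstructure N,
      #S < κ ∧ C ⊆ (S : Set N) ∧ TypeEq L (S : Set N) d e) a b

/-- The global type `p(x)` is Lascar-invariant over `C`: whether `φ(x; d)` belongs to `p`
depends only on the Lascar strong type of `d` over `C`. -/
def GlobalType.IsLascarInvariant {ι : Type w'} (p : GlobalType L N ι) (κ : Cardinal.{w})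
    (C : Set N) : Prop :=
  ∀ (n : ℕ) (φ : L.Formula (ι ⊕ Fin n)) (d e : Fin n → N), LascarEq L κ C d e →
    (Formula.equivSentence (inst φ d) ∈ p ↔ Formula.equivSentence (inst φ e) ∈ p)

end Types

section Independence

variable (L : FirstOrder.Language.{u, v}) {N : Type w} [L.Structure N]

/-- `IndI L κ A C B` is `A ⫝ⁱ_C B`: the type `tp(A/BC)` extends to a global type which is
Lascar-invariant over `C`. -/
def IndI (κ : Cardinal.{w}) (A C B : Set N) : Prop :=
  ∃ p : GlobalType L N A,
    p.Extends (B ∪ C) (fun x : A => (x : N)) ∧ p.IsLascarInvariant κ C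

/-- `IndCI L κ A C B` is `A ⫝ᶜⁱ_C B`, the dual of `⫝ⁱ`. -/
def IndCI (κ : Cardinal.{w}) (A C B : Set N) : Prop :=
  IndI L κ B C A

/-- `IndU L A C B` is `A ⫝ᵘ_C B`: the type `tp(A/BC)` is finitely satisfiable in `C`.
(The type is closed under conjunction, so single formulas suffice.) -/
def IndU (A C B : Set N) : Prop :=
  ∀ ψ : L[[(B ∪ C : Set N)]].Formula A, ψ.Realize (fun x : A => (x : N)) →
    ∃ c : A → N, (∀ x, c x ∈ C) ∧ ψ.Realize c

/-- `IndH L A C B` is `A ⫝ʰ_C B`, the dual of `⫝ᵘ`. -/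
def IndH (A C B : Set N) : Prop :=
  IndU L B C A

/-- Weak independent amalgamation over models, for a ternary relation on small subsets of the
monster model `N`, where `Ind A C B` stands for `A ⫝_C B`: for every small elementary
substructure `M` and all small tuples with `b₀c₀ ≡_M b₁c₁`, `bᵢ ⫝_M cᵢ` and `c₀ ⫝_M c₁`, there is
`b` with `bc₀ ≡_M bc₁ ≡_M b₀c₀`. -/
def WeakIndependentAmalgamation (κ : Cardinal.{w}) (Ind : Set N → Set N → Set N → Prop) : Prop :=
  ∀ M : L.ElementarySubstructure N, #M < κ →
    ∀ ι ι' : Type w, #ι < κ → #ι' < κ →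
      ∀ (b₀ b₁ : ι → N) (c₀ c₁ : ι' → N),
        TypeEq L (M : Set N) (Sum.elim b₀ c₀) (Sum.elim b₁ c₁) →
        Ind (Set.range b₀) (M : Set N) (Set.range c₀) →
        Ind (Set.range b₁) (M : Set N) (Set.range c₁) →
        Ind (Set.range c₀) (M : Set N) (Set.range c₁) →
        ∃ b : ι → N,
          TypeEq L (M : Set N) (Sum.elim b c₀) (Sum.elim b c₁) ∧
          TypeEq L (M : Set N) (Sum.elim b c₁) (Sum.elim b₀ c₀)

end Independence

section SOP1

variable {L : FirstOrder.Language.{u, v}} {N : Type w} [L.Structure N]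

/-- The set of formulas `{φ(x; a) : a ∈ P}` is consistent (with the elementary diagram of `N`),
i.e. finitely satisfiable in `N`. -/
def InstancesConsistent {m n : ℕ} (φ : L.Formula (Fin m ⊕ Fin n)) (P : Set (Fin n → N)) : Prop :=
  ∀ F : Finset (Fin n → N), (F : Set (Fin n → N)) ⊆ P →
    ∃ x : Fin m → N, ∀ a ∈ F, φ.Realize (Sum.elim x a)

/-- The formula `φ(x; y)` and the tree `a` of parameters, indexed by finite binary sequences,
exemplify `SOP₁`. -/
def ExemplifiesSOP1 {m n : ℕ} (φ : L.Formula (Fin m ⊕ Fin n))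
    (a : List Bool → Fin n → N) : Prop :=
  (∀ η : ℕ → Bool, InstancesConsistent φ
    (Set.range fun k : ℕ => a (List.ofFn fun i : Fin k => η i))) ∧
  (∀ η ν : List Bool, (η ++ [false]) <+: ν →
    ¬ InstancesConsistent φ {a (η ++ [true]), a ν})

/-- Some formula exemplifies `SOP₁` in some model of `T`. -/
def HasSOP1 (T : L.Theory) : Prop :=
  ∃ (N : Theory.ModelType.{u, v, max u v} T) (m n : ℕ) (φ : L.Formula (Fin m ⊕ Fin n))
    (a : List Bool → Fin n → N), ExemplifiesSOP1 φ a

/-- `T` is `NSOP₁`. -/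
def IsNSOP1 (T : L.Theory) : Prop := ¬ HasSOP1 T

end SOP1

end ModelTheoreticIndependence

/-! The cycle 1 → 2 → 3 → 1 is proved. For 1 → 2, a type finitely satisfiable in a set is the
restriction of an ultrapower type concentrated on that set, and such a global type is invariant
(`IndU.indI`). So the hypotheses of amalgamation for the coheir relation are stronger than those for
the invariant one.

For 3 → 1, suppose `b₀c₀`, `b₁c₁` cannot be amalgamated. By compactness a single formula `ψ` in the
type of `b₀c₀` over `M` has contradictory instances at `c₁` and `c₀`. Let `P`, `Q` be global
`M`-invariant types realized by `c₀` over `Mb₀` and by `c₁` over `Mc₀`. Trees for SOP₁ are grown at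
the root (`IsAmalgamationTree.exists_join`, `exists_tree`). Given a tree, realize `Q` over it and
move a conjugate of the tree so that its root is this realization: by invariance of `Q` the new root
is incompatible with every node of the old tree. Put the conjugate on side 1, the old tree on side
0, and a realization of `P` over both as common root. Invariance of `P` keeps branches consistent,
since a witness for a branch can be conjugated to remain a witness together with the new root.
Compactness then gives an infinite tree.

For 2 → 3, an SOP₁ tree contains, by the pigeonhole principle (`exists_array_nodes`), two columns of
nodes: one lies on a branch, the other is pairwise inconsistent, and in each row the two entries
agree on prescribed formulas over Skolem terms in earlier rows. Compactness yields such an array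
inside a small model `M`, with both columns having the same limit type over `M`
(`HasSOP1.exists_isSOP1Array`). Limits of the columns along a nonprincipal ultrafilter are finitely
satisfiable in `M`. The consistent column supplies the pairs `b₀c₀`, `b₁c₁`, and the inconsistent
column supplies `c₁` over `c₀`; an amalgam would satisfy two contradictory instances. -/

namespace ModelTheoreticIndependence

/-! ### Formulas in infinitely many variables: quantification and finite support. -/

section Projection

variable {L : FirstOrder.Language.{u, v}}

open Classical in
/-- The existential closure of a formula in a possibly infinite block of variables. -/
noncomputable def projection {X Z : Type*} (ψ : L.Formula (X ⊕ Z)) : L.Formula Z :=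
  Formula.iExs (BoundedFormula.freeVarFinset ψ)
    (BoundedFormula.restrictFreeVar ψ
      (fun a => Sum.rec (motive := fun s => s = (a : X ⊕ Z) →
          Z ⊕ BoundedFormula.freeVarFinset ψ)
        (fun _ _ => Sum.inr a) (fun z _ => Sum.inl z) (a : X ⊕ Z) rfl))

theorem realize_projection {X Z : Type*} {K : Type*} [L.Structure K] [Nonempty K]
    (ψ : L.Formula (X ⊕ Z)) (z : Z → K) :
    (projection ψ).Realize z ↔ ∃ x : X → K, ψ.Realize (Sum.elim x z) := by
  classical
  rw [projection, Formula.realize_iExs]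
  constructor
  · rintro ⟨i, hi⟩
    refine ⟨fun x => if h : Sum.inl x ∈ BoundedFormula.freeVarFinset ψ then i ⟨_, h⟩
      else Classical.arbitrary K, ?_⟩
    refine (BoundedFormula.realize_restrictFreeVar _ ?_).1 hi
    rintro ⟨x | z, h⟩
    · simp [h]
    · simp
  · rintro ⟨x, hx⟩
    refine ⟨fun a => Sum.elim x z a, ?_⟩
    refine (BoundedFormula.realize_restrictFreeVar _ ?_).2 hx
    rintro ⟨x | z, h⟩ <;> simp

/-- Only finitely many variables occur in `ψ`. Two universes appear because the same `φ` must be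
read both in the monster and in an elementary extension of it. -/
theorem exists_finite_right_support {X Y : Type*} (ψ : L.Formula (X ⊕ Y)) :
    ∃ (n : ℕ) (t : Fin n → Y) (φ : L.Formula (X ⊕ Fin n)),
      (∀ (K : Type w) [L.Structure K] (x : X → K) (y : Y → K),
        φ.Realize (Sum.elim x (y ∘ t)) ↔ ψ.Realize (Sum.elim x y)) ∧
      ∀ (K : Type w') [L.Structure K] (x : X → K) (y : Y → K),
        φ.Realize (Sum.elim x (y ∘ t)) ↔ ψ.Realize (Sum.elim x y) := by
  classical
  let F := (BoundedFormula.freeVarFinset ψ).toRight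
  have key : ∀ a : BoundedFormula.freeVarFinset ψ, ∃ b : X ⊕ Fin F.card,
      Sum.map id (fun i => (F.equivFin.symm i : Y)) b = (a : X ⊕ Y) := by
    rintro ⟨x | y, h⟩
    · exact ⟨Sum.inl x, rfl⟩
    · exact ⟨Sum.inr (F.equivFin ⟨y, by simpa [F] using h⟩), by simp⟩
  choose f hf using key
  refine ⟨F.card, fun i => F.equivFin.symm i, BoundedFormula.restrictFreeVar ψ f,
    fun K _ x y => BoundedFormula.realize_restrictFreeVar _ fun a => ?_,
    fun K _ x y => BoundedFormula.realize_restrictFreeVar _ fun a => ?_⟩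
  all_goals
    rw [← hf a]
    rcases f a with b | b <;> rfl

/-- Injectivity of `s` lets every finite tuple be extended to an `X`-tuple, so inconsistency of `ψ`
passes to `φ`. -/
theorem exists_finite_left_support {X Y : Type*} (ψ : L.Formula (X ⊕ Y)) :
    ∃ (m : ℕ) (s : Fin m → X) (φ : L.Formula (Fin m ⊕ Y)), Function.Injective s ∧
      ∀ (K : Type w) [L.Structure K]
      (x : X → K) (y : Y → K), φ.Realize (Sum.elim (x ∘ s) y) ↔ ψ.Realize (Sum.elim x y) := by
  classical
  let F := (BoundedFormula.freeVarFinset ψ).toLeft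
  have key : ∀ a : BoundedFormula.freeVarFinset ψ, ∃ b : Fin F.card ⊕ Y,
      Sum.map (fun i => (F.equivFin.symm i : X)) id b = (a : X ⊕ Y) := by
    rintro ⟨x | y, h⟩
    · exact ⟨Sum.inl (F.equivFin ⟨x, by simpa [F] using h⟩), by simp⟩
    · exact ⟨Sum.inr y, rfl⟩
  choose f hf using key
  refine ⟨F.card, fun i => F.equivFin.symm i, BoundedFormula.restrictFreeVar ψ f,
    fun i j h => F.equivFin.symm.injective (Subtype.ext h),
    fun K _ x y => BoundedFormula.realize_restrictFreeVar _ fun a => ?_⟩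
  rw [← hf a]
  rcases f a with b | b <;> rfl

theorem realize_congr_freeVars {X K : Type*} [L.Structure K] [DecidableEq X] (ψ : L.Formula X)
    {x y : X → K} (h : ∀ a ∈ BoundedFormula.freeVarFinset ψ, x a = y a) :
    ψ.Realize x ↔ ψ.Realize y := by
  refine (BoundedFormula.realize_restrictFreeVar (f := id)
    (v := fun a : BoundedFormula.freeVarFinset ψ => x a) x fun a => rfl).symm.trans
    (BoundedFormula.realize_restrictFreeVar (f := id) y fun a => h a a.2)

/-- A formula satisfiable in one model of a complete theory is satisfiable in every model. -/
theorem exists_realize_of_isComplete {T : L.Theory} (hT : T.IsComplete) {K N : Type*}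
    [L.Structure K] [L.Structure N] [Nonempty K] [Nonempty N] [K ⊨ T] [N ⊨ T] {X : Type*}
    (ψ : L.Formula X) {x : X → K} (hx : ψ.Realize x) : ∃ y : X → N, ψ.Realize y := by
  let χ : L.Sentence := projection (ψ.relabel (Sum.inl : X → X ⊕ Empty))
  have hχK : K ⊨ χ := (realize_projection _ _).2 ⟨x, by
    rwa [Formula.realize_relabel, Sum.elim_comp_inl]⟩
  have hχN : N ⊨ χ := (hT.realize_sentence_iff χ N).2 ((hT.realize_sentence_iff χ K).1 hχK)
  obtain ⟨y, hy⟩ := (realize_projection _ _).1 hχN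
  rw [Formula.realize_relabel, Sum.elim_comp_inl] at hy
  exact ⟨y, hy⟩

end Projection

/-! ### Types of tuples, homogeneity and saturation in the monster. -/

section Monster

variable {L : FirstOrder.Language.{u, v}} {N : Type w} [L.Structure N]

/-- Two families of elements of `N` satisfy the same formulas. -/
def SameType (L : FirstOrder.Language.{u, v}) {N : Type w} [L.Structure N] {X : Type*}
    (a b : X → N) : Prop :=
  ∀ φ : L.Formula X, φ.Realize a ↔ φ.Realize b

namespace SameType

variable {X Y : Type*} {a b c : X → N}

theorem symm (h : SameType L a b) : SameType L b a := fun φ => (h φ).symm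

theorem trans (h : SameType L a b) (h' : SameType L b c) : SameType L a c :=
  fun φ => (h φ).trans (h' φ)

theorem comp (h : SameType L a b) (f : Y → X) : SameType L (a ∘ f) (b ∘ f) := fun φ => by
  simpa only [Formula.realize_relabel] using h (φ.relabel f)

theorem of_equiv (σ : N ≃[L] N) (a : X → N) : SameType L (σ ∘ a) a := fun φ =>
  StrongHomClass.realize_formula σ φ

theorem eq_iff (h : SameType L a b) (i j : X) : a i = a j ↔ b i = b j := by
  simpa using h (Term.equal (Term.var i) (Term.var j))

end SameType

theorem realize_constantsVarsEquiv_val (A : Set N) {ι : Type*} (ψ : L[[A]].Formula ι)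
    (x : ι → N) :
    Formula.Realize (BoundedFormula.constantsVarsEquiv ψ : L.Formula (A ⊕ ι))
      (Sum.elim Subtype.val x) ↔ ψ.Realize x :=
  BoundedFormula.realize_constantsVarsEquiv (L := L) (M := N) (φ := ψ) (v := x) (xs := default)

theorem realize_constantsVarsEquiv_symm_val (A : Set N) {ι : Type*} (ψ : L.Formula (A ⊕ ι))
    (x : ι → N) :
    Formula.Realize (BoundedFormula.constantsVarsEquiv.symm ψ : L[[A]].Formula ι) x ↔
      ψ.Realize (Sum.elim Subtype.val x) := by
  rw [← realize_constantsVarsEquiv_val]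
  erw [Equiv.apply_symm_apply]

theorem typeEq_iff_sameType (A : Set N) {ι : Type w'} (a b : ι → N) :
    TypeEq L A a b ↔
      SameType L (Sum.elim (Subtype.val : A → N) a) (Sum.elim (Subtype.val : A → N) b) := by
  constructor
  · intro h φ
    simpa only [realize_constantsVarsEquiv_symm_val] using
      h (BoundedFormula.constantsVarsEquiv.symm φ)
  · intro h ψ
    rw [← realize_constantsVarsEquiv_val, ← realize_constantsVarsEquiv_val]
    exact h _

theorem TypeEq.mono {A B : Set N} (hAB : A ⊆ B) {ι : Type w'} {a b : ι → N}
    (h : TypeEq L B a b) : TypeEq L A a b := by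
  rw [typeEq_iff_sameType] at h ⊢
  convert h.comp (Sum.map (Set.inclusion hAB) id) using 1 <;> ext (i | i) <;> rfl

theorem LascarEq.typeEq {κ : Cardinal.{w}} {A : Set N} {ι : Type w'} {a b : ι → N}
    (h : LascarEq L κ A a b) : TypeEq L A a b := by
  induction h with
  | refl => exact fun _ => Iff.rfl
  | tail _ h ih =>
    obtain ⟨S, -, hS, h⟩ := h
    exact fun ψ => (ih ψ).trans (h.mono hS ψ)

/-- Over a small model the chain has one step, the model itself being the witness. Hence Lascar
invariance over a model is plain invariance. -/
theorem lascarEq_of_typeEq {κ : Cardinal.{w}} {M : L.ElementarySubstructure N} (hM : #M < κ)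
    {ι : Type w'} {a b : ι → N} (h : TypeEq L (M : Set N) a b) :
    LascarEq L κ (M : Set N) a b :=
  Relation.ReflTransGen.single ⟨M, hM, subset_rfl, h⟩

/-- Tuples may repeat entries. Coincidences of entries are part of the type, so the map between the
ranges is well defined. -/
theorem IsStronglyHomogeneous.exists_equiv {κ : Cardinal.{w}}
    (hN : IsStronglyHomogeneous L N κ) {X : Type w} (hX : #X < κ) {a b : X → N}
    (h : SameType L a b) : ∃ σ : N ≃[L] N, σ ∘ a = b := by
  obtain ⟨s, hs⟩ : ∃ s : Set.range a → X, ∀ y, a (s y) = y :=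
    ⟨fun y => y.2.choose, fun y => y.2.choose_spec⟩
  obtain ⟨σ, hσ⟩ := hN (Set.range a) (b ∘ s) (mk_range_le.trans_lt hX) fun φ => by
    have := h (φ.relabel s)
    rw [Formula.realize_relabel, Formula.realize_relabel] at this
    convert this using 2
    funext y
    exact (hs y).symm
  refine ⟨σ, funext fun i => ?_⟩
  exact (hσ ⟨a i, i, rfl⟩).trans ((h.eq_iff _ _).1 (hs _))

theorem IsSaturated.exists_realize_one {κ : Cardinal.{w}} (hN : IsSaturated L N κ)
    (A : Set N) (hA : #A < κ) (Γ : Set (L.Formula (A ⊕ Unit)))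
    (hΓ : ∀ Δ : Finset (L.Formula (A ⊕ Unit)), (Δ : Set _) ⊆ Γ →
      ∃ x : N, ∀ ψ ∈ Δ, ψ.Realize (Sum.elim Subtype.val fun _ => x)) :
    ∃ x : N, ∀ ψ ∈ Γ, ψ.Realize (Sum.elim Subtype.val fun _ => x) := by
  classical
  obtain ⟨x, hx⟩ := hN A hA
    {θ | (BoundedFormula.constantsVarsEquiv θ : L.Formula (A ⊕ Unit)) ∈ Γ} fun Δ hΔ => by
      obtain ⟨x, hx⟩ := hΓ (Δ.image fun θ => BoundedFormula.constantsVarsEquiv θ) (by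
        intro ψ hψ
        obtain ⟨θ, hθ, rfl⟩ := Finset.mem_image.1 (Finset.mem_coe.1 hψ)
        exact hΔ hθ)
      exact ⟨x, fun ψ hψ => (realize_constantsVarsEquiv_val _ _ _).1
        (hx _ (Finset.mem_image_of_mem _ hψ))⟩
  refine ⟨x, fun ψ hψ => ?_⟩
  rw [← realize_constantsVarsEquiv_symm_val]
  refine hx _ ?_
  have : BoundedFormula.constantsVarsEquiv (BoundedFormula.constantsVarsEquiv.symm ψ) = ψ :=
    Equiv.apply_symm_apply _ _
  exact (congrArg (· ∈ Γ) this).mpr hψ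

/-- In a `κ`-saturated structure, finitely satisfiable sets of formulas in fewer than `κ`
variables and fewer than `κ` parameters are realized. -/
theorem IsSaturated.exists_realize [Nonempty N] {κ : Cardinal.{w}} (hN : IsSaturated L N κ)
    (hκ : ℵ₀ ≤ κ) {ι Y : Type*} (hι : lift.{w} #ι < lift κ) (hY : lift.{w} #Y < lift κ)
    (y : Y → N) (Γ : Set (L.Formula (ι ⊕ Y)))
    (hΓ : ∀ Δ : Finset (L.Formula (ι ⊕ Y)), (Δ : Set _) ⊆ Γ →
      ∃ e : ι → N, ∀ ψ ∈ Δ, ψ.Realize (Sum.elim e y)) :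
    ∃ e : ι → N, ∀ ψ ∈ Γ, ψ.Realize (Sum.elim e y) := by
  classical
  -- Zorn's lemma runs over sets of prescribed values that stay finitely consistent with `Γ`; a
  -- maximal one turns out to be the graph of the realization.
  let Good : Set (ι × N) → Prop := fun G =>
    ∀ (Δ : Finset (L.Formula (ι ⊕ Y))) (G₀ : Finset (ι × N)), (Δ : Set _) ⊆ Γ →
      (G₀ : Set _) ⊆ G → ∃ e : ι → N, (∀ p ∈ G₀, e p.1 = p.2) ∧ ∀ ψ ∈ Δ, ψ.Realize (Sum.elim e y)
  obtain ⟨G, -, hG⟩ := zorn_subset_nonempty {G | Good G} (fun c hc hc' hne => by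
    refine ⟨⋃₀ c, fun Δ G₀ hΔ hG₀ => ?_, fun s hs => Set.subset_sUnion_of_mem hs⟩
    obtain ⟨s, hs, hs'⟩ := DirectedOn.exists_mem_subset_of_finset_subset_biUnion (f := id) hne
      hc'.directedOn (by simpa [Set.sUnion_eq_biUnion] using hG₀)
    exact hc hs Δ G₀ hΔ hs') ∅ (fun Δ G₀ hΔ hG₀ => by
      obtain ⟨e, he⟩ := hΓ Δ hΔ
      refine ⟨e, fun p hp => (hG₀ hp).elim, he⟩)
  have hgood : Good G := hG.1
  have hfun : ∀ p ∈ G, ∀ q ∈ G, p.1 = q.1 → p = q := by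
    intro p hp q hq hpq
    obtain ⟨e, he, -⟩ := hgood ∅ {p, q} (by simp) (by
      intro r hr
      rcases Finset.mem_insert.1 (Finset.mem_coe.1 hr) with rfl | hr
      · exact hp
      · exact (Finset.mem_singleton.1 hr) ▸ hq)
    refine Prod.ext hpq ?_
    rw [← he p (by simp), ← he q (by simp), hpq]
  have htot : ∀ i, ∃ x, (i, x) ∈ G := by
    intro i
    let A : Set N := Set.range y ∪ Prod.snd '' G
    -- `G` is the graph of a partial function on `ι`, so it uses at most `#ι` values.
    have hA : #A < κ := by
      refine (mk_union_le _ _).trans_lt (add_lt_of_lt hκ ?_ ?_)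
      · rw [← lift_lt]
        exact (mk_range_le_lift (f := y)).trans_lt hY
      · obtain ⟨s, hs⟩ : ∃ s : (Prod.snd '' G) → ι, ∀ z, (s z, (z : N)) ∈ G :=
          ⟨fun z => z.2.choose.1, fun z => by
            have := z.2.choose_spec
            rw [← this.2]
            exact this.1⟩
        have hs' : Function.Injective s := fun z z' h =>
          Subtype.ext (Prod.ext_iff.1 (hfun _ (hs z) _ (hs z') h)).2
        rw [← lift_lt]
        exact (lift_mk_le_lift_mk_of_injective hs').trans_lt hι
    -- Quantifying out all coordinates but `i` reduces the choice of the value at `i` to saturation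
    -- in one variable.
    have hdef : ∀ (Δ : Finset (L.Formula (ι ⊕ Y))) (G₀ : Finset (ι × N)), (G₀ : Set _) ⊆ G →
        ∃ θ : L.Formula (A ⊕ Unit), ∀ x : N, θ.Realize (Sum.elim Subtype.val fun _ => x) ↔
          ∃ e : ι → N, e i = x ∧ (∀ p ∈ G₀, e p.1 = p.2) ∧ ∀ ψ ∈ Δ, ψ.Realize (Sum.elim e y) := by
      intro Δ G₀ hG₀
      let yA : Y → A := fun j => ⟨y j, Or.inl ⟨j, rfl⟩⟩
      let gA : G₀ → A := fun p => ⟨p.1.2, Or.inr ⟨p.1, hG₀ p.2, rfl⟩⟩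
      let ψ₀ : L.Formula (ι ⊕ (A ⊕ Unit)) :=
        Term.equal (Term.var (Sum.inl i)) (Term.var (Sum.inr (Sum.inr ()))) ⊓
        (Formula.iInf (fun p : G₀ =>
          Term.equal (Term.var (Sum.inl p.1.1)) (Term.var (Sum.inr (Sum.inl (gA p))))) ⊓
        Formula.iInf (fun ψ : Δ => Formula.relabel (Sum.map id (Sum.inl ∘ yA)) ψ.1))
      refine ⟨projection ψ₀, fun x => (realize_projection _ _).trans (exists_congr fun e => ?_)⟩
      rw [Formula.realize_inf, Formula.realize_inf, Formula.realize_iInf, Formula.realize_iInf]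
      refine and_congr (by simp) (and_congr ?_ ?_)
      · simp [gA]
      · simp only [Formula.realize_relabel, Subtype.forall]
        refine forall₂_congr fun ψ _ => ?_
        rw [show Sum.elim e (Sum.elim Subtype.val fun _ => x) ∘ Sum.map id (Sum.inl ∘ yA) =
          Sum.elim e y by ext (j | j) <;> rfl]
    obtain ⟨x, hx⟩ := hN.exists_realize_one A hA
      {θ | ∃ (Δ : Finset (L.Formula (ι ⊕ Y))) (G₀ : Finset (ι × N)), (Δ : Set _) ⊆ Γ ∧
        (G₀ : Set _) ⊆ G ∧ ∀ x : N, θ.Realize (Sum.elim Subtype.val fun _ => x) ↔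
          ∃ e : ι → N, e i = x ∧ (∀ p ∈ G₀, e p.1 = p.2) ∧
            ∀ ψ ∈ Δ, ψ.Realize (Sum.elim e y)} (by
      intro Θ hΘ
      choose! D H hD hH hDH using hΘ
      obtain ⟨e, he, he'⟩ := hgood (Θ.biUnion D) (Θ.biUnion H)
        (by
          intro ψ hψ
          obtain ⟨θ, hθ, hψ⟩ := Finset.mem_biUnion.1 (Finset.mem_coe.1 hψ)
          exact hD hθ hψ)
        (by
          intro ψ hψ
          obtain ⟨θ, hθ, hψ⟩ := Finset.mem_biUnion.1 (Finset.mem_coe.1 hψ)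
          exact hH hθ hψ)
      exact ⟨e i, fun θ hθ => (hDH hθ _).2 ⟨e, rfl,
        fun p hp => he p (Finset.mem_biUnion.2 ⟨θ, hθ, hp⟩),
        fun ψ hψ => he' ψ (Finset.mem_biUnion.2 ⟨θ, hθ, hψ⟩)⟩⟩)
    refine ⟨x, hG.mem_of_prop_insert ?_⟩
    intro Δ G₀ hΔ hG₀
    have hsub : ((G₀.erase (i, x) : Finset _) : Set (ι × N)) ⊆ G := by
      intro p hp
      rw [Finset.coe_erase] at hp
      exact (hG₀ hp.1).resolve_left hp.2
    obtain ⟨θ, hθ⟩ := hdef Δ (G₀.erase (i, x)) hsub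
    obtain ⟨e, hei, he, he'⟩ := (hθ x).1 (hx θ ⟨Δ, _, hΔ, hsub, hθ⟩)
    refine ⟨e, fun p hp => ?_, he'⟩
    by_cases hpi : p = (i, x)
    · rw [hpi]; exact hei
    · exact he p (Finset.mem_erase.2 ⟨hpi, hp⟩)
  choose f hf using htot
  refine ⟨f, fun ψ hψ => ?_⟩
  let F := (BoundedFormula.freeVarFinset ψ).toLeft
  obtain ⟨e, he, he'⟩ := hgood {ψ} (F.image fun i => (i, f i)) (by simpa using hψ) (by
    intro p hp
    obtain ⟨i, -, rfl⟩ := Finset.mem_image.1 (Finset.mem_coe.1 hp)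
    exact hf i)
  refine (realize_congr_freeVars ψ ?_).1 (he' ψ (Finset.mem_singleton_self _))
  rintro (j | j) hj
  · exact he (j, f j) (Finset.mem_image.2 ⟨j, by simpa [F] using hj, rfl⟩)
  · rfl

end Monster

/-! ### Coheirs extend to invariant global types. -/

section Coheir

variable {L : FirstOrder.Language.{u, v}} {N : Type w} [L.Structure N]

/-- The filter of tuples from `C` generated by the type of `A` over `B ∪ C`. -/
def IndU.filter {A C B : Set N} (_h : IndU L A C B) : Filter (A → N) where
  sets := {s | ∃ ψ : L[[(B ∪ C : Set N)]].Formula A, ψ.Realize (fun x : A => (x : N)) ∧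
    {c | (∀ x, c x ∈ C) ∧ ψ.Realize c} ⊆ s}
  univ_sets := ⟨⊤, Formula.realize_top.2 trivial, Set.subset_univ _⟩
  sets_of_superset := fun ⟨ψ, h₁, h₂⟩ hst => ⟨ψ, h₁, Set.Subset.trans h₂ hst⟩
  inter_sets := fun ⟨ψ, h₁, h₂⟩ ⟨θ, h₃, h₄⟩ => ⟨ψ ⊓ θ, Formula.realize_inf.2 ⟨h₁, h₃⟩,
    fun _ hc => ⟨h₂ ⟨hc.1, (Formula.realize_inf.1 hc.2).1⟩,
      h₄ ⟨hc.1, (Formula.realize_inf.1 hc.2).2⟩⟩⟩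

theorem IndU.filter_neBot {A C B : Set N} (h : IndU L A C B) : h.filter.NeBot := by
  refine ⟨fun hbot => ?_⟩
  obtain ⟨ψ, h₁, h₂⟩ : (∅ : Set (A → N)) ∈ h.filter := hbot ▸ Filter.mem_bot
  obtain ⟨c, hc⟩ := h ψ h₁
  exact h₂ hc

/-- Coheirs are invariant: finite satisfiability in `C` implies Lascar-invariant extendability. -/
theorem IndU.indI [Nonempty N] {κ : Cardinal.{w}} {A C B : Set N} (h : IndU L A C B) :
    IndI L κ A C B := by
  have := h.filter_neBot
  let U : Ultrafilter (A → N) := Ultrafilter.of h.filter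
  have hU : (U : Filter (A → N)) ≤ h.filter := Ultrafilter.of_le _
  let K := (U : Filter (A → N)).Product fun _ => N
  let _ : L[[N]].Structure K := Ultraproduct.structure
  have hK : K ⊨ L.elementaryDiagram N := by
    refine ⟨fun φ hφ => ?_⟩
    exact (Ultraproduct.sentence_realize φ).2 (Filter.Eventually.of_forall fun _ => hφ)
  let v : A → K := fun x => ((fun c : A → N => c x : (A → N) → N) : K)
  have hp : ∀ (n : ℕ) (φ : L.Formula (A ⊕ Fin n)) (d : Fin n → N),
      Formula.equivSentence (inst φ d) ∈ (L.elementaryDiagram N).typeOf v ↔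
        ∀ᶠ c in (U : Filter (A → N)), φ.Realize (Sum.elim c d) := by
    intro n φ d
    rw [Theory.CompleteType.formula_mem_typeOf]
    refine (Ultraproduct.realize_formula_cast (inst φ d) fun (x : A) (c : A → N) => c x).trans ?_
    simp only [realize_inst]
  refine ⟨(L.elementaryDiagram N).typeOf v, fun n φ d hd hφ => ?_, fun n φ d e hde => ?_⟩
  · rw [hp]
    refine hU ?_
    refine ⟨BoundedFormula.constantsVarsEquiv.symm (Formula.relabel
      (Sum.elim Sum.inr fun i => Sum.inl ⟨d i, hd i⟩) φ : L.Formula ((B ∪ C : Set N) ⊕ A)),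
      ?_, ?_⟩
    · rw [realize_constantsVarsEquiv_symm_val, Formula.realize_relabel]
      convert hφ using 1
      ext (i | i) <;> rfl
    · rintro c ⟨-, hc⟩
      rw [realize_constantsVarsEquiv_symm_val, Formula.realize_relabel] at hc
      change φ.Realize (Sum.elim c d)
      convert hc using 1
      ext (i | i) <;> rfl
  -- The ultrafilter concentrates on tuples from `C`, so membership of `φ(x; d)` depends only on the
  -- type of `d` over `C`, which is coarser than its Lascar strong type.
  · rw [hp, hp]
    refine Filter.eventually_congr ?_
    have : ∀ᶠ c in (U : Filter (A → N)), ∀ x, c x ∈ C :=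
      hU ⟨⊤, Formula.realize_top.2 trivial, fun c hc => hc.1⟩
    filter_upwards [this] with c hc
    have h' := (typeEq_iff_sameType _ _ _).1 hde.typeEq
    have := (h'.comp (Sum.elim (fun x : A => Sum.inl (⟨c x, hc x⟩ : C)) Sum.inr)) φ
    convert this using 2 <;> ext (i | i) <;> rfl

end Coheir

/-! ### Global types invariant under automorphisms fixing the base. -/

section Invariant

variable {L : FirstOrder.Language.{u, v}} {N : Type w} [L.Structure N]

/-- `P` is a complete type over `N`, in the form of a set of formulas with parameters, which is
invariant under automorphisms fixing `M`. -/
structure IsInvariantType {ι : Type*} (M : Set N) (P : Set (L.Formula (ι ⊕ N))) : Prop where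
  finSat : ∀ Δ : Finset (L.Formula (ι ⊕ N)), (Δ : Set _) ⊆ P →
    ∃ e : ι → N, ∀ ψ ∈ Δ, ψ.Realize (Sum.elim e id)
  complete : ∀ ψ, ψ ∈ P ∨ ψ.not ∈ P
  invariant : ∀ σ : N ≃[L] N, (∀ m ∈ M, σ m = m) →
    ∀ ψ ∈ P, Formula.relabel (Sum.map id σ) ψ ∈ P

/-- `e` realizes the restriction of the type `P` to the parameters `y`. -/
def RealizesOver {ι Y : Type*} (P : Set (L.Formula (ι ⊕ N))) (y : Y → N) (e : ι → N) : Prop :=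
  ∀ φ : L.Formula (ι ⊕ Y), Formula.relabel (Sum.map id y) φ ∈ P → φ.Realize (Sum.elim e y)

theorem IsInvariantType.mem_of_imp {ι : Type*} {M : Set N} {P : Set (L.Formula (ι ⊕ N))}
    (hP : IsInvariantType M P) {ψ θ : L.Formula (ι ⊕ N)} (hψ : ψ ∈ P)
    (h : ∀ e : ι → N, ψ.Realize (Sum.elim e id) → θ.Realize (Sum.elim e id)) : θ ∈ P := by
  classical
  refine (hP.complete θ).resolve_right fun hθ => ?_
  obtain ⟨e, he⟩ := hP.finSat {ψ, θ.not} (by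
    intro χ hχ
    rcases Finset.mem_insert.1 (Finset.mem_coe.1 hχ) with rfl | hχ
    · exact hψ
    · exact (Finset.mem_singleton.1 hχ) ▸ hθ)
  exact Formula.realize_not.1 (he θ.not (by simp)) (h e (he ψ (by simp)))

theorem IsInvariantType.realizesOver_comp {ι Y Z : Type*} {M : Set N}
    {P : Set (L.Formula (ι ⊕ N))} (hP : IsInvariantType M P) {y : Y → N} {e : ι → N}
    (h : RealizesOver P y e) (f : Z → Y) : RealizesOver P (y ∘ f) e := by
  intro φ hφ
  have := h (Formula.relabel (Sum.map id f) φ) (hP.mem_of_imp hφ fun e he => by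
    rw [Formula.realize_relabel] at he
    rw [Formula.realize_relabel, Formula.realize_relabel]
    convert he using 1
    ext (i | i) <;> rfl)
  rw [Formula.realize_relabel] at this
  convert this using 1
  ext (i | i) <;> rfl

/-- Invariance puts `φ(x; y)` in `P` only if `φ(x; y')` is there too, and completeness of `P` makes
each realization decide such formulas as `P` does. -/
theorem IsInvariantType.sameType {ι Y : Type*} {M : Set N} {P : Set (L.Formula (ι ⊕ N))}
    (hP : IsInvariantType M P) {y y' : Y → N} {e e' : ι → N} (h : RealizesOver P y e)
    (h' : RealizesOver P y' e') (σ : N ≃[L] N) (hσ : ∀ m ∈ M, σ m = m) (hy : σ ∘ y = y') :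
    SameType L (Sum.elim e y) (Sum.elim e' y') := by
  have key : ∀ φ : L.Formula (ι ⊕ Y), φ.Realize (Sum.elim e y) → φ.Realize (Sum.elim e' y') := by
    intro φ hφ
    refine h' φ (hP.mem_of_imp (hP.invariant σ hσ (Formula.relabel (Sum.map id y) φ) ?_) ?_)
    · refine (hP.complete _).resolve_right fun hn => ?_
      refine Formula.realize_not.1 (h φ.not (hP.mem_of_imp hn fun e he => ?_)) hφ
      rw [Formula.realize_relabel, Formula.realize_not]
      rwa [Formula.realize_not, Formula.realize_relabel] at he
    · intro e he
      rw [Formula.realize_relabel, Formula.realize_relabel] at he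
      rw [Formula.realize_relabel]
      convert he using 1
      rw [← hy]
      ext (i | i) <;> rfl
  refine fun φ => ⟨key φ, fun hφ => ?_⟩
  by_contra hn
  exact Formula.realize_not.1 (key φ.not (Formula.realize_not.2 hn)) hφ

theorem IsInvariantType.sameType_sum {ι : Type*} {M : Set N} {P : Set (L.Formula (ι ⊕ N))}
    (hP : IsInvariantType M P) {Y : Type*} {y : Y → N} {e e' : ι → N} (h : RealizesOver P y e)
    (h' : RealizesOver P y e') : SameType L (Sum.elim y e) (Sum.elim y e') := by
  convert (hP.sameType h h' (FirstOrder.Language.Equiv.refl L N) (fun _ _ => rfl) rfl).comp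
    Sum.swap using 1 <;> ext (i | i) <;> rfl

theorem IsInvariantType.exists_realizesOver [Nonempty N] {κ : Cardinal.{w}}
    (hN : IsSaturated L N κ) (hκ : ℵ₀ ≤ κ) {ι Y : Type w} {M : Set N}
    {P : Set (L.Formula (ι ⊕ N))} (hP : IsInvariantType M P) (hι : #ι < κ) (hY : #Y < κ)
    (y : Y → N) : ∃ e, RealizesOver P y e := by
  classical
  refine hN.exists_realize hκ (lift_lt.2 hι) (lift_lt.2 hY) y
    {φ : L.Formula (ι ⊕ Y) | Formula.relabel (Sum.map id y) φ ∈ P} fun Δ hΔ => ?_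
  obtain ⟨e, he⟩ := hP.finSat (Δ.image fun φ => Formula.relabel (Sum.map id y) φ) (by
    intro ψ hψ
    obtain ⟨φ, hφ, rfl⟩ := Finset.mem_image.1 (Finset.mem_coe.1 hψ)
    exact hΔ hφ)
  refine ⟨e, fun φ hφ => ?_⟩
  have := he _ (Finset.mem_image_of_mem _ hφ)
  rw [Formula.realize_relabel] at this
  convert this using 1
  ext (i | i) <;> rfl

/-- A global type is the type of a tuple in an elementary extension. -/
theorem exists_elementary_realization [Nonempty N] {ι : Type w} (p : GlobalType L N ι) :
    ∃ (K : Type (max u v w)) (_ : L.Structure K) (j : N → K) (x : ι → K),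
      (∀ ψ : L.Formula N, ψ.Realize j ↔ ψ.Realize (id : N → N)) ∧
      ∀ (n : ℕ) (φ : L.Formula (ι ⊕ Fin n)) (a : Fin n → N),
        Formula.equivSentence (inst φ a) ∈ p ↔ φ.Realize (Sum.elim x (j ∘ a)) := by
  obtain ⟨K, x, rfl⟩ := Theory.exists_modelType_is_realized_in _ p
  let _ := (L.lhomWithConstants N).reduct K
  refine ⟨K, inferInstance, fun a => (L.con a : K), x, fun ψ => ?_, fun n φ a => ?_⟩
  · rw [← Formula.realize_equivSentence K ψ]
    have h := Formula.realize_equivSentence (L := L) N ψ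
    refine Iff.trans ?_ h
    have hK : K ⊨ L[[N]].completeTheory N := K.is_model
    exact realize_iff_of_model_completeTheory N K _
  · rw [Theory.CompleteType.formula_mem_typeOf]
    have h := BoundedFormula.realize_constantsVarsEquiv (L := L) (M := K) (φ := inst φ a) (v := x)
      (xs := default)
    rw [inst, Equiv.apply_symm_apply] at h
    refine h.symm.trans ((Formula.realize_relabel (φ := φ)).trans ?_)
    have : Sum.elim (fun b : N => ((L.con b : L[[N]].Constants) : K)) x ∘
        Sum.elim Sum.inr (fun j => Sum.inl (a j)) =
          Sum.elim x ((fun b : N => ((L.con b : L[[N]].Constants) : K)) ∘ a) := by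
      funext i
      rcases i with i | j
      · rfl
      · rfl
    rw [this]

/-- The global type is realized in an elementary extension and re-read along the tuple `c`, whose
index set replaces its range. This gives one set of formulas on which automorphisms act directly. -/
theorem IndI.exists_isInvariantType [Nonempty N] {κ : Cardinal.{w}} {ι : Type w} {c : ι → N}
    {M : L.ElementarySubstructure N} (hM : #M < κ) {B : Set N}
    (h : IndI L κ (Set.range c) M B) :
    ∃ P : Set (L.Formula (ι ⊕ N)), IsInvariantType (M : Set N) P ∧
      ∀ {Y : Type w} (y : Y → N), (∀ i, y i ∈ B ∪ (M : Set N)) → RealizesOver P y c := by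
  obtain ⟨p, hp, hinv⟩ := h
  obtain ⟨K, _, j, x, hj, hx⟩ := exists_elementary_realization p
  let c' : ι → Set.range c := fun i => ⟨c i, i, rfl⟩
  let P : Set (L.Formula (ι ⊕ N)) := {ψ | ψ.Realize (Sum.elim (x ∘ c') j)}
  have hKne : Nonempty K := ⟨j (Classical.arbitrary N)⟩
  have hfin : ∀ {Y : Type w} (ψ : L.Formula (ι ⊕ Y)), ∃ (n : ℕ) (t : Fin n → Y)
      (φ : L.Formula (Set.range c ⊕ Fin n)),
        (∀ y : Y → N, φ.Realize (Sum.elim Subtype.val (y ∘ t)) ↔ ψ.Realize (Sum.elim c y)) ∧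
        ∀ y : Y → N, Formula.equivSentence (inst φ (y ∘ t)) ∈ p ↔
          ψ.Realize (Sum.elim (x ∘ c') (j ∘ y)) := by
    intro Y ψ
    obtain ⟨n, t, φ, h₁, h₂⟩ := exists_finite_right_support.{u, v, w, max u v w}
      (Formula.relabel (Sum.map c' id) ψ)
    refine ⟨n, t, φ, fun y => ?_, fun y => ?_⟩
    · rw [h₁, Formula.realize_relabel]
      rw [show Sum.elim Subtype.val y ∘ Sum.map c' id = Sum.elim c y by ext (i | i) <;> rfl]
    · rw [hx, ← Function.comp_assoc, h₂, Formula.realize_relabel]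
      rw [show Sum.elim x (j ∘ y) ∘ Sum.map c' id = Sum.elim (x ∘ c') (j ∘ y) by
        ext (i | i) <;> rfl]
  refine ⟨P, ⟨fun Δ hΔ => ?_, fun ψ => ?_, fun σ hσ ψ hψ => ?_⟩, fun {Y} y hy φ hφ => ?_⟩
  · let χ : L.Formula (ι ⊕ N) := Formula.iInf (fun ψ : Δ => (ψ : L.Formula (ι ⊕ N)))
    have h₁ : (projection χ).Realize j := (realize_projection _ _).2
      ⟨x ∘ c', Formula.realize_iInf.2 fun ψ => hΔ ψ.2⟩
    obtain ⟨e, he⟩ := (realize_projection _ _).1 ((hj _).1 h₁)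
    exact ⟨e, fun ψ hψ => Formula.realize_iInf.1 he ⟨ψ, hψ⟩⟩
  · exact or_iff_not_imp_left.2 fun h => Formula.realize_not.2 h
  · obtain ⟨n, t, φ, -, h₂⟩ := hfin ψ
    have hψ' : Formula.equivSentence (inst φ (id ∘ t)) ∈ p := (h₂ id).2 hψ
    -- An automorphism fixing `M` preserves types over `M`, and `M` is a small model.
    have hL : LascarEq L κ (M : Set N) t (σ ∘ t) := by
      refine lascarEq_of_typeEq hM ((typeEq_iff_sameType _ _ _).2 (SameType.symm ?_))
      convert SameType.of_equiv σ (Sum.elim (fun m : ((M : Set N) : Type w) => (m : N)) t) using 1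
      ext (i | i)
      · exact (hσ i i.2).symm
      · rfl
    have := (h₂ σ).1 ((hinv n φ _ _ hL).1 hψ')
    change Formula.Realize _ _
    rw [Formula.realize_relabel]
    convert this using 1
    ext (i | i) <;> rfl
  · by_contra hn
    obtain ⟨n, t, θ, h₁, h₂⟩ := hfin φ.not
    have := (h₂ y).1 (hp n θ (y ∘ t) (fun i => hy _) ((h₁ y).2 (Formula.realize_not.2 hn)))
    refine Formula.realize_not.1 this ?_
    change Formula.Realize _ _ at hφ
    rw [Formula.realize_relabel] at hφ
    convert hφ using 1
    ext (i | i) <;> rfl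

end Invariant

theorem mk_sum_lt {κ : Cardinal.{w}} (hκ : ℵ₀ ≤ κ) {X Y : Type w} (hX : #X < κ) (hY : #Y < κ) :
    #(X ⊕ Y) < κ := by
  rw [mk_sum, lift_id, lift_id]
  exact add_lt_of_lt hκ hX hY

theorem mk_countable_prod_lt {κ : Cardinal.{w}} (hκ : ℵ₀ < κ) {B : Type} [Countable B]
    {X : Type w} (hX : #X < κ) : #(B × X) < κ := by
  rw [mk_prod]
  refine mul_lt_of_lt hκ.le (lt_of_le_of_lt ?_ hκ) (by simpa using hX)
  simp

/-! ### Growing SOP₁ trees from two invariant types. -/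

section Tree

variable {L : FirstOrder.Language.{u, v}} {N : Type w} [L.Structure N]

/-- A tree of tuples, considered up to height `n`, whose branches are realized by conjugates of
`b` together with conjugates of `c`, and whose nodes satisfy the incompatibility `I` required by
`SOP₁`. -/
structure IsAmalgamationTree {ι ι' : Type w} (M : Set N) (b : ι → N) (c : ι' → N)
    (I : (ι' → N) → (ι' → N) → Prop) (n : ℕ) (a : List Bool → ι' → N) : Prop where
  path : ∀ η : List Bool, η.length ≤ n → ∃ b' : ι → N, ∀ ν, ν <+: η →
    SameType L (Sum.elim (Sum.elim (Subtype.val : M → N) b') (a ν))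
      (Sum.elim (Sum.elim (Subtype.val : M → N) b) c)
  incompatible : ∀ η ν : List Bool, ν.length ≤ n → η ++ [false] <+: ν →
    I (a (η ++ [true])) (a ν)

namespace IsAmalgamationTree

variable {ι ι' : Type w} {M : Set N} {b : ι → N} {c : ι' → N}
  {I : (ι' → N) → (ι' → N) → Prop} {n : ℕ} {a : List Bool → ι' → N}

theorem node (h : IsAmalgamationTree (L := L) M b c I n a) {η : List Bool} (hη : η.length ≤ n) :
    SameType L (Sum.elim (Subtype.val : M → N) (a η)) (Sum.elim (Subtype.val : M → N) c) := by
  obtain ⟨b', hb'⟩ := h.path η hη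
  convert (hb' η List.prefix_rfl).comp (Sum.map Sum.inl id) using 1 <;> ext (i | i) <;> rfl

theorem map (h : IsAmalgamationTree (L := L) M b c I n a) (σ : N ≃[L] N)
    (hσ : ∀ m ∈ M, σ m = m) (hI : ∀ d e, I d e → I (σ ∘ d) (σ ∘ e)) :
    IsAmalgamationTree (L := L) M b c I n (fun η => σ ∘ a η) where
  path η hη := by
    obtain ⟨b', hb'⟩ := h.path η hη
    refine ⟨σ ∘ b', fun ν hν => SameType.trans ?_ (hb' ν hν)⟩
    convert SameType.of_equiv σ (Sum.elim (Sum.elim (Subtype.val : M → N) b') (a ν)) using 1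
    ext ((i | i) | i)
    · exact (hσ i i.2).symm
    · rfl
    · rfl
  incompatible η ν hν hην := hI _ _ (h.incompatible η ν hν hην)

/-- Joining two trees below a common root. -/
def join (d : ι' → N) (t : Bool → List Bool → ι' → N) : List Bool → ι' → N
  | [] => d
  | i :: η => t i η

variable {κ : Cardinal.{w}} {P Q : Set (L.Formula (ι' ⊕ N))}

/-- The new root realizes `P` over both subtrees. Incompatibilities at the root are exactly `hI`;
those higher up lie within one subtree. -/
theorem exists_join [Nonempty N] (hsat : IsSaturated L N κ) (hhom : IsStronglyHomogeneous L N κ)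
    (hκ : ℵ₀ < κ) (hM : #M < κ) (hι : #ι < κ) (hι' : #ι' < κ)
    (hP : IsInvariantType M P) (hPc : RealizesOver P (Sum.elim (Subtype.val : M → N) b) c)
    {t : Bool → List Bool → ι' → N} (ht : ∀ i, IsAmalgamationTree (L := L) M b c I n (t i))
    (hI : ∀ ν : List Bool, ν.length ≤ n → I (t true []) (t false ν)) :
    ∃ d, IsAmalgamationTree (L := L) M b c I (n + 1) (join d t) := by
  let y : M ⊕ ((Bool × List Bool) × ι') → N :=
    Sum.elim Subtype.val fun p => t p.1.1 p.1.2 p.2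
  have hY : #(M ⊕ ((Bool × List Bool) × ι') : Type w) < κ :=
    mk_sum_lt hκ.le hM (mk_countable_prod_lt hκ hι')
  obtain ⟨d, hd⟩ := hP.exists_realizesOver hsat hκ.le hι' hY y
  refine ⟨d, ⟨fun η hη => ?_, fun η ν hν hην => ?_⟩⟩
  · rcases η with - | ⟨i, η⟩
    · obtain ⟨σ, hσ⟩ := hhom.exists_equiv (mk_sum_lt hκ.le hM hι')
        (hP.sameType_sum (hP.realizesOver_comp hPc Sum.inl) (hP.realizesOver_comp hd Sum.inl))
      refine ⟨σ ∘ b, fun ν hν => ?_⟩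
      rw [List.prefix_nil.1 hν]
      convert SameType.of_equiv σ (Sum.elim (Sum.elim (Subtype.val : M → N) b) c) using 1
      ext ((m | i) | i)
      · exact (congrFun hσ (Sum.inl m)).symm
      · rfl
      · exact (congrFun hσ (Sum.inr i)).symm
    · obtain ⟨b', hb'⟩ := (ht i).path η (by simpa using hη)
      -- The root `d` was chosen without regard to `b'`. Choose `d'` realizing `P` over `b'` as
      -- well, so that `b'd'` looks like `bc` over `M`, then move `d'` to `d` by some `τ` fixing
      -- both trees; the branch witness becomes `τ ∘ b'`.
      obtain ⟨d', hd'⟩ := hP.exists_realizesOver hsat hκ.le hι' (mk_sum_lt hκ.le hY hι)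
        (Sum.elim y b')
      have hyd : SameType L (Sum.elim d' y) (Sum.elim d y) :=
        hP.sameType (hP.realizesOver_comp hd' Sum.inl) hd (FirstOrder.Language.Equiv.refl L N)
          (fun _ _ => rfl) rfl
      obtain ⟨τ, hτ⟩ := hhom.exists_equiv (mk_sum_lt hκ.le hι' hY) hyd
      have hτM : ∀ m : M, τ m = m := fun m => congrFun hτ (Sum.inr (Sum.inl m))
      refine ⟨τ ∘ b', fun ν hν => ?_⟩
      rcases ν with - | ⟨j, ν⟩
      · have hbb : SameType L (Sum.elim (Subtype.val : M → N) b')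
            (Sum.elim (Subtype.val : M → N) b) := (hb' η List.prefix_rfl).comp Sum.inl
        obtain ⟨σ, hσ⟩ := hhom.exists_equiv (mk_sum_lt hκ.le hM hι) hbb
        have hdc := hP.sameType (y := Sum.elim (Subtype.val : M → N) b')
          (by convert hP.realizesOver_comp hd' (Sum.map Sum.inl id) using 1
              ext (i | i) <;> rfl) hPc σ
          (fun m hm => congrFun hσ (Sum.inl ⟨m, hm⟩)) hσ
        refine SameType.trans ?_ (SameType.trans (hdc.comp Sum.swap) ?_)
        · convert SameType.of_equiv τ
            (Sum.elim d' (Sum.elim (Subtype.val : M → N) b') ∘ Sum.swap) using 1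
          ext ((m | i) | i)
          · exact (hτM m).symm
          · rfl
          · exact (congrFun hτ (Sum.inl i)).symm
        · have h : Sum.elim c (Sum.elim Subtype.val b) ∘ Sum.swap =
              Sum.elim (Sum.elim (Subtype.val : M → N) b) c := by
            ext ((m | i) | i) <;> rfl
          rw [h]
          exact fun φ => Iff.rfl
      · obtain ⟨rfl, hν'⟩ := List.cons_prefix_cons.1 hν
        refine SameType.trans ?_ (hb' ν hν')
        convert SameType.of_equiv τ
          (Sum.elim (Sum.elim (Subtype.val : M → N) b') (t j ν)) using 1
        ext ((m | i) | i)
        · exact (hτM m).symm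
        · rfl
        · exact (congrFun hτ (Sum.inr (Sum.inr ((j, ν), i)))).symm
  · rcases η with - | ⟨i, η⟩
    · rcases ν with - | ⟨j, ν⟩
      · simp at hην
      · obtain ⟨rfl, -⟩ := List.cons_prefix_cons.1 hην
        exact hI ν (by simpa using hν)
    · rcases ν with - | ⟨j, ν⟩
      · simp at hην
      · obtain ⟨rfl, hην'⟩ := List.cons_prefix_cons.1 hην
        exact (ht i).incompatible η ν (by simpa using hν) hην'

theorem exists_tree [Nonempty N] (hsat : IsSaturated L N κ) (hhom : IsStronglyHomogeneous L N κ)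
    (hκ : ℵ₀ < κ) (hM : #M < κ) (hι : #ι < κ) (hι' : #ι' < κ)
    (hP : IsInvariantType M P) (hPc : RealizesOver P (Sum.elim (Subtype.val : M → N) b) c)
    (hQ : IsInvariantType M Q) {c' : ι' → N}
    (hQc : RealizesOver Q (Sum.elim (Subtype.val : M → N) c) c')
    (hcc : SameType L (Sum.elim (Subtype.val : M → N) c') (Sum.elim (Subtype.val : M → N) c))
    (hI : ∀ σ : N ≃[L] N, (∀ m ∈ M, σ m = m) → ∀ d e, I d e → I (σ ∘ d) (σ ∘ e))
    (hIc : I c' c) (n : ℕ) :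
    ∃ a, IsAmalgamationTree (L := L) M b c I n a := by
  induction n with
  | zero =>
    refine ⟨fun _ => c, ⟨fun η _ => ⟨b, fun ν _ φ => Iff.rfl⟩, fun η ν hν hην => ?_⟩⟩
    have := hην.length_le
    simp at this
    omega
  | succ n ih =>
    obtain ⟨a, ha⟩ := ih
    let y : M ⊕ (List Bool × ι') → N := Sum.elim Subtype.val fun p => a p.1 p.2
    -- Since `e` realizes `Q` over the whole tree and each node is conjugate to `c`, every pair `(e,
    -- a ν)` is conjugate to `(c', c)` over `M`, hence incompatible. The copy with root `e` goes on
    -- the `true` side.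
    obtain ⟨e, he⟩ := hQ.exists_realizesOver hsat hκ.le hι'
      (mk_sum_lt hκ.le hM (mk_countable_prod_lt hκ hι')) y
    have hec : SameType L (Sum.elim (Subtype.val : M → N) e)
        (Sum.elim (Subtype.val : M → N) c') :=
      hQ.sameType_sum (hQ.realizesOver_comp he Sum.inl) (hQ.realizesOver_comp hQc Sum.inl)
    obtain ⟨σ, hσ⟩ := hhom.exists_equiv (mk_sum_lt hκ.le hM hι')
      (((ha.node (η := []) (Nat.zero_le _)).trans hcc.symm).trans hec.symm)
    have hσM : ∀ m ∈ M, σ m = m := fun m hm => congrFun hσ (Sum.inl ⟨m, hm⟩)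
    obtain ⟨d, hd⟩ := exists_join (t := fun i η => if i then σ ∘ a η else a η)
      hsat hhom hκ hM hι hι' hP hPc (n := n) (I := I) (by
        rintro (- | -)
        · simpa using ha
        · simpa using ha.map σ hσM (hI σ hσM)) (by
        intro ν hν
        have h₁ : (σ ∘ a [] : ι' → N) = e := funext fun i => congrFun hσ (Sum.inr i)
        simp only [if_true, h₁, Bool.false_eq_true, if_false]
        obtain ⟨τ, hτ⟩ := hhom.exists_equiv (mk_sum_lt hκ.le hM hι') (ha.node hν).symm
        have hs := hQ.sameType hQc
          (y' := Sum.elim (Subtype.val : M → N) (a ν)) (e' := e)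
          (by convert hQ.realizesOver_comp he (Sum.map id fun i => (ν, i)) using 1
              ext (i | i) <;> rfl) τ
          (fun m hm => congrFun hτ (Sum.inl ⟨m, hm⟩)) hτ
        obtain ⟨ρ, hρ⟩ := hhom.exists_equiv
          (mk_sum_lt hκ.le hι' (mk_sum_lt hκ.le hM hι')) hs
        have := hI ρ (fun m hm => congrFun hρ (Sum.inr (Sum.inl ⟨m, hm⟩))) c' c hIc
        convert this using 1
        · exact funext fun i => (congrFun hρ (Sum.inl i)).symm
        · exact funext fun i => (congrFun hρ (Sum.inr (Sum.inr i))).symm)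
    exact ⟨_, hd⟩

end IsAmalgamationTree

end Tree

/-! ### From finite trees to SOP₁. -/

section Compactness

variable {L : FirstOrder.Language.{u, v}} {T : L.Theory} {N : Type w} [L.Structure N] [N ⊨ T]
  [Nonempty N]

/-- Compactness for sets of formulas. -/
theorem exists_modelType_realize {X : Type} (Γ : Set (L.Formula X))
    (hΓ : ∀ Δ : Finset (L.Formula X), (Δ : Set _) ⊆ Γ → ∃ x : X → N, ∀ ψ ∈ Δ, ψ.Realize x) :
    ∃ (K : Theory.ModelType.{u, v, max u v} T) (x : X → K), ∀ ψ ∈ Γ, ψ.Realize x := by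
  classical
  have hsat : ((L.lhomWithConstants X).onTheory T ∪
      Formula.equivSentence '' Γ : L[[X]].Theory).IsSatisfiable := by
    rw [Theory.isSatisfiable_iff_isFinitelySatisfiable]
    intro T₀ hT₀
    obtain ⟨x, hx⟩ := hΓ ((T₀.image Formula.equivSentence.symm).filter (· ∈ Γ)) (by
      intro ψ hψ
      exact (Finset.mem_filter.1 (Finset.mem_coe.1 hψ)).2)
    let _ : (constantsOn X).Structure N := constantsOn.structure x
    have : N ⊨ (T₀ : L[[X]].Theory) := by
      refine ⟨fun θ hθ => ?_⟩
      rcases hT₀ hθ with h | ⟨ψ, hψ, rfl⟩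
      · have : N ⊨ (L.lhomWithConstants X).onTheory T :=
          (LHom.onTheory_model _ T).2 inferInstance
        exact this.realize_of_mem _ h
      · refine (Formula.realize_equivSentence N ψ).2 (hx ψ ?_)
        exact Finset.mem_filter.2 ⟨Finset.mem_image.2 ⟨_, hθ, Equiv.symm_apply_apply _ _⟩, hψ⟩
    exact Theory.Model.isSatisfiable N
  obtain ⟨K⟩ := hsat
  let _ := (L.lhomWithConstants X).reduct K
  have hK : K ⊨ T := (LHom.onTheory_model (L.lhomWithConstants X) T).1
    (K.is_model.mono Set.subset_union_left)
  refine ⟨Theory.ModelType.of T K, fun i => (L.con i : K), fun ψ hψ => ?_⟩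
  exact (Formula.realize_equivSentence K ψ).1
    (K.is_model.realize_of_mem _ (Or.inr ⟨ψ, hψ, rfl⟩))

/-- The variables of `φ(x; y)` with the block `y` renamed to the node `η`. -/
def atNode {m n : ℕ} (φ : L.Formula (Fin m ⊕ Fin n)) (η : List Bool) :
    L.Formula (Fin m ⊕ (List Bool × Fin n)) :=
  φ.relabel (Sum.map id fun k => (η, k))

theorem realize_atNode {m n : ℕ} (φ : L.Formula (Fin m ⊕ Fin n)) (η : List Bool) {K : Type*}
    [L.Structure K] (x : Fin m → K) (a : List Bool × Fin n → K) :
    (atNode φ η).Realize (Sum.elim x a) ↔ φ.Realize (Sum.elim x fun k => a (η, k)) := by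
  rw [atNode, Formula.realize_relabel]
  rw [show Sum.elim x a ∘ Sum.map id (fun k => (η, k)) = Sum.elim x fun k => a (η, k) by
    ext (i | i) <;> rfl]

open Classical in
/-- The formula expressing that `φ` is consistent along the initial segments of `η`. -/
noncomputable def branchFormula {m n : ℕ} (φ : L.Formula (Fin m ⊕ Fin n)) (η : List Bool) :
    L.Formula (List Bool × Fin n) :=
  projection (Formula.iInf fun ν : η.inits.toFinset => atNode φ ν)

theorem realize_branchFormula {m n : ℕ} (φ : L.Formula (Fin m ⊕ Fin n)) {K : Type*}
    [L.Structure K] [Nonempty K] (η : List Bool) (a : List Bool × Fin n → K) :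
    (branchFormula φ η).Realize a ↔
      ∃ x : Fin m → K, ∀ ν, ν <+: η → φ.Realize (Sum.elim x fun k => a (ν, k)) := by
  refine (realize_projection _ _).trans (exists_congr fun x => ?_)
  simp [Formula.realize_iInf, realize_atNode]

/-- `SOP₁` follows from the existence of trees of all finite heights in one model. -/
theorem hasSOP1_of_finite_trees {m n : ℕ} (φ : L.Formula (Fin m ⊕ Fin n))
    (h : ∀ k : ℕ, ∃ a : List Bool → Fin n → N,
      (∀ η : List Bool, η.length ≤ k → ∃ x : Fin m → N, ∀ ν, ν <+: η →
        φ.Realize (Sum.elim x (a ν))) ∧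
      ∀ η ν : List Bool, ν.length ≤ k → η ++ [false] <+: ν →
        ¬ ∃ x : Fin m → N, φ.Realize (Sum.elim x (a (η ++ [true]))) ∧
          φ.Realize (Sum.elim x (a ν))) : HasSOP1 T := by
  classical
  let incF : List Bool → List Bool → L.Formula (List Bool × Fin n) := fun η ν =>
    (projection (atNode φ (η ++ [true]) ⊓ atNode φ ν)).not
  obtain ⟨K, a, ha⟩ := exists_modelType_realize (T := T) (N := N)
    (Set.range (branchFormula φ) ∪ {θ | ∃ η ν : List Bool, η ++ [false] <+: ν ∧ θ = incF η ν}) (by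
    intro Δ hΔ
    have hk : ∀ θ ∈ Δ, ∃ k : ℕ, ∀ a : List Bool × Fin n → N,
        (∀ η : List Bool, η.length ≤ k → ∃ x : Fin m → N, ∀ ν, ν <+: η →
          φ.Realize (Sum.elim x fun i => a (ν, i))) →
        (∀ η ν : List Bool, ν.length ≤ k → η ++ [false] <+: ν →
          ¬ ∃ x : Fin m → N, φ.Realize (Sum.elim x fun i => a (η ++ [true], i)) ∧
            φ.Realize (Sum.elim x fun i => a (ν, i))) → θ.Realize a := by
      intro θ hθ
      rcases hΔ hθ with ⟨η, rfl⟩ | ⟨η, ν, hην, rfl⟩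
      · exact ⟨η.length, fun a h₁ _ => (realize_branchFormula φ η a).2 (h₁ η le_rfl)⟩
      · refine ⟨ν.length, fun a _ h₂ => Formula.realize_not.2 fun hx => h₂ η ν le_rfl hην ?_⟩
        obtain ⟨x, hx⟩ := (realize_projection _ _).1 hx
        rw [Formula.realize_inf, realize_atNode, realize_atNode] at hx
        exact ⟨x, hx⟩
    choose! k hk using hk
    obtain ⟨a, h₁, h₂⟩ := h (Δ.sup k)
    exact ⟨fun p => a p.1 p.2, fun θ hθ => hk θ hθ _
      (fun η hη => h₁ η (hη.trans (Finset.le_sup hθ)))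
      (fun η ν hν => h₂ η ν (hν.trans (Finset.le_sup hθ)))⟩)
  refine ⟨K, m, n, φ, fun η i => a (η, i), fun η F hF => ?_, fun η ν hην hcon => ?_⟩
  · choose! k hk using fun b (hb : b ∈ F) => hF hb
    obtain ⟨x, hx⟩ := (realize_branchFormula φ _ a).1
      (ha _ (Or.inl ⟨List.ofFn fun i : Fin (F.sup k) => η i, rfl⟩))
    refine ⟨x, fun b hb => ?_⟩
    rw [← hk b hb]
    refine hx _ ?_
    obtain ⟨l, hl⟩ := Nat.exists_eq_add_of_le (Finset.le_sup (f := k) hb)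
    rw [hl, List.ofFn_add]
    exact List.prefix_append _ _
  · obtain ⟨x, hx⟩ := hcon {fun i => a (η ++ [true], i), fun i => a (ν, i)} (by simp)
    refine Formula.realize_not.1 (ha _ (Or.inr ⟨η, ν, hην, rfl⟩)) ((realize_projection _ _).2
      ⟨x, ?_⟩)
    rw [Formula.realize_inf, realize_atNode, realize_atNode]
    exact ⟨hx _ (by simp), hx _ (by simp)⟩

end Compactness

/-! ### NSOP₁ implies amalgamation for `IndCI`, which implies it for `IndH`. -/

section Amalgamation

variable {L : FirstOrder.Language.{u, v}} {N : Type w} [L.Structure N] [Nonempty N]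
  {κ : Cardinal.{w}}

/-- If amalgamation fails, this is witnessed by a single formula. -/
theorem exists_formula_of_not_exists_amalgam (hsat : IsSaturated L N κ) (hκ : ℵ₀ ≤ κ)
    {M : Set N} (hM : #M < κ) {ι ι' : Type w} (hι : #ι < κ) (hι' : #ι' < κ) {b₀ : ι → N}
    {c₀ c₁ : ι' → N}
    (h : ¬ ∃ b : ι → N, TypeEq L M (Sum.elim b c₀) (Sum.elim b c₁) ∧
      TypeEq L M (Sum.elim b c₁) (Sum.elim b₀ c₀)) :
    ∃ ψ : L.Formula (ι ⊕ (ι' ⊕ M)), ψ.Realize (Sum.elim b₀ (Sum.elim c₀ Subtype.val)) ∧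
      ¬ ∃ b : ι → N, ψ.Realize (Sum.elim b (Sum.elim c₁ Subtype.val)) ∧
        ψ.Realize (Sum.elim b (Sum.elim c₀ Subtype.val)) := by
  classical
  by_contra! hcon
  let y : (ι' ⊕ ι') ⊕ M → N := Sum.elim (Sum.elim c₀ c₁) Subtype.val
  let f₀ : ι ⊕ (ι' ⊕ M) → ι ⊕ ((ι' ⊕ ι') ⊕ M) := Sum.map id (Sum.map Sum.inl id)
  let f₁ : ι ⊕ (ι' ⊕ M) → ι ⊕ ((ι' ⊕ ι') ⊕ M) := Sum.map id (Sum.map Sum.inr id)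
  have hf₀ : ∀ b : ι → N, Sum.elim b y ∘ f₀ = Sum.elim b (Sum.elim c₀ Subtype.val) := by
    intro b
    ext (i | i | i) <;> rfl
  have hf₁ : ∀ b : ι → N, Sum.elim b y ∘ f₁ = Sum.elim b (Sum.elim c₁ Subtype.val) := by
    intro b
    ext (i | i | i) <;> rfl
  obtain ⟨b, hb⟩ := hsat.exists_realize hκ (lift_lt.2 hι)
    (lift_lt.2 (mk_sum_lt hκ (mk_sum_lt hκ hι' hι') hM)) y
    {θ | ∃ χ : L.Formula (ι ⊕ (ι' ⊕ M)), χ.Realize (Sum.elim b₀ (Sum.elim c₀ Subtype.val)) ∧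
      (θ = Formula.relabel f₀ χ ∨ θ = Formula.relabel f₁ χ)} (by
    intro Δ hΔ
    have hΔ' : ∀ θ ∈ Δ, ∃ χ : L.Formula (ι ⊕ (ι' ⊕ M)),
        χ.Realize (Sum.elim b₀ (Sum.elim c₀ Subtype.val)) ∧
          (θ = Formula.relabel f₀ χ ∨ θ = Formula.relabel f₁ χ) := fun θ hθ => hΔ hθ
    choose! χ hχ hχ' using hΔ'
    obtain ⟨b, hb₁, hb₀⟩ := hcon (Formula.iInf fun θ : Δ => χ θ)
      (Formula.realize_iInf.2 fun θ => hχ θ θ.2)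
    refine ⟨b, fun θ hθ => ?_⟩
    rcases hχ' θ hθ with h | h
    · rw [h, Formula.realize_relabel, hf₀]
      exact Formula.realize_iInf.1 hb₀ ⟨θ, hθ⟩
    · rw [h, Formula.realize_relabel, hf₁]
      exact Formula.realize_iInf.1 hb₁ ⟨θ, hθ⟩)
  have key : ∀ χ : L.Formula (ι ⊕ (ι' ⊕ M)),
      χ.Realize (Sum.elim b₀ (Sum.elim c₀ Subtype.val)) →
        χ.Realize (Sum.elim b (Sum.elim c₀ Subtype.val)) ∧
          χ.Realize (Sum.elim b (Sum.elim c₁ Subtype.val)) := by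
    intro χ hχ
    have h₀ := hb _ ⟨χ, hχ, Or.inl rfl⟩
    have h₁ := hb _ ⟨χ, hχ, Or.inr rfl⟩
    rw [Formula.realize_relabel, hf₀] at h₀
    rw [Formula.realize_relabel, hf₁] at h₁
    exact ⟨h₀, h₁⟩
  have h₀ : SameType L (Sum.elim b (Sum.elim c₀ (Subtype.val : M → N)))
      (Sum.elim b₀ (Sum.elim c₀ Subtype.val)) := fun χ =>
    ⟨fun h => by
      by_contra hn
      exact Formula.realize_not.1 (key χ.not (Formula.realize_not.2 hn)).1 h,
      fun h => (key χ h).1⟩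
  have h₁ : SameType L (Sum.elim b (Sum.elim c₁ (Subtype.val : M → N)))
      (Sum.elim b₀ (Sum.elim c₀ Subtype.val)) := fun χ =>
    ⟨fun h => by
      by_contra hn
      exact Formula.realize_not.1 (key χ.not (Formula.realize_not.2 hn)).2 h,
      fun h => (key χ h).2⟩
  let g : M ⊕ (ι ⊕ ι') → ι ⊕ (ι' ⊕ M) :=
    Sum.elim (Sum.inr ∘ Sum.inr) (Sum.elim Sum.inl (Sum.inr ∘ Sum.inl))
  refine h ⟨b, (typeEq_iff_sameType _ _ _).2 ?_, (typeEq_iff_sameType _ _ _).2 ?_⟩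
  · convert (h₀.trans h₁.symm).comp g using 1 <;> ext (i | i | i) <;> rfl
  · convert h₁.comp g using 1 <;> ext (i | i | i) <;> rfl

theorem weakIndependentAmalgamation_indCI_of_isNSOP1 {T : L.Theory} [N ⊨ T]
    (hN : IsMonster L N κ) (hT : IsNSOP1 T) :
    WeakIndependentAmalgamation L κ (IndCI L κ (N := N)) := by
  intro M hM ι ι' hι hι' b₀ b₁ c₀ c₁ h₀₁ h₀ h₁ hc
  by_contra hno
  obtain ⟨ψ, hψ, hψ'⟩ := exists_formula_of_not_exists_amalgam hN.saturated hN.aleph0_lt.le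
    (M := (M : Set N)) hM hι hι' hno
  obtain ⟨P, hP, hPc⟩ := IndI.exists_isInvariantType hM h₀
  obtain ⟨Q, hQ, hQc⟩ := IndI.exists_isInvariantType hM hc
  obtain ⟨m, s, φ₁, hs, hφ₁⟩ := exists_finite_left_support.{u, v, w} ψ
  obtain ⟨n, t, φ, hφ, -⟩ := exists_finite_right_support.{u, v, w, w} φ₁
  have hφψ : ∀ (b : ι → N) (a : ι' → N),
      φ.Realize (Sum.elim (b ∘ s) (Sum.elim a Subtype.val ∘ t)) ↔
        ψ.Realize (Sum.elim b (Sum.elim a Subtype.val)) := fun b a =>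
    (hφ N _ _).trans (hφ₁ N _ _)
  have hcc : SameType L (Sum.elim (Subtype.val : ((M : Set N) : Type w) → N) c₁)
      (Sum.elim (Subtype.val : ((M : Set N) : Type w) → N) c₀) := by
    convert (((typeEq_iff_sameType _ _ _).1 h₀₁).symm).comp (Sum.map id Sum.inr) using 1 <;>
      ext (i | i) <;> rfl
  refine hT (hasSOP1_of_finite_trees (N := N) φ fun k => ?_)
  obtain ⟨a, ha⟩ := IsAmalgamationTree.exists_tree hN.saturated hN.homogeneous hN.aleph0_lt
    hM hι hι' hP (hPc (Sum.elim Subtype.val b₀) (by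
      rintro (i | i)
      · exact Or.inr i.2
      · exact Or.inl ⟨i, rfl⟩)) hQ (hQc (Sum.elim Subtype.val c₀) (by
      rintro (i | i)
      · exact Or.inr i.2
      · exact Or.inl ⟨i, rfl⟩)) hcc
    (I := fun d e => ¬ ∃ b : ι → N, ψ.Realize (Sum.elim b (Sum.elim d Subtype.val)) ∧
      ψ.Realize (Sum.elim b (Sum.elim e Subtype.val))) (by
      rintro σ hσ d e hI ⟨b, hb₁, hb₂⟩
      have key : ∀ d : ι' → N, ψ.Realize (Sum.elim b (Sum.elim (σ ∘ d) Subtype.val)) →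
          ψ.Realize (Sum.elim (σ.symm ∘ b) (Sum.elim d Subtype.val)) := by
        intro d hd
        refine (SameType.of_equiv σ _ ψ).1 ?_
        convert hd using 1
        ext (i | i | i)
        · exact σ.apply_symm_apply _
        · rfl
        · exact hσ i i.2
      exact hI ⟨σ.symm ∘ b, key d hb₁, key e hb₂⟩) hψ' k
  -- The parameters of `ψ` from `M` are absorbed into every node, so that `φ` itself is without
  -- parameters.
  refine ⟨fun η => Sum.elim (a η) Subtype.val ∘ t, fun η hη => ?_, fun η ν hν hην => ?_⟩
  · obtain ⟨b', hb'⟩ := ha.path η hη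
    refine ⟨b' ∘ s, fun ν hν => (hφψ _ _).2 ?_⟩
    have := (hb' ν hν).comp (Sum.elim (Sum.inl ∘ Sum.inr)
      (Sum.elim Sum.inr (Sum.inl ∘ Sum.inl)) : ι ⊕ (ι' ⊕ _) → _)
    convert (this ψ).2 ?_ using 1
    · ext (i | i | i) <;> rfl
    · convert hψ using 1
      ext (i | i | i) <;> rfl
  · rintro ⟨x, hx₁, hx₂⟩
    obtain ⟨b, rfl⟩ := hs.surjective_comp_right x
    exact ha.incompatible η ν hν hην ⟨b, (hφψ _ _).1 hx₁, (hφψ _ _).1 hx₂⟩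

theorem weakIndependentAmalgamation_indH_of_indCI
    (h : WeakIndependentAmalgamation L κ (IndCI L κ (N := N))) :
    WeakIndependentAmalgamation L κ (IndH L (N := N)) :=
  fun M hM ι ι' hι hι' b₀ b₁ c₀ c₁ h₀₁ h₀ h₁ hc =>
    h M hM ι ι' hι hι' b₀ b₁ c₀ c₁ h₀₁ h₀.indI h₁.indI hc.indI

end Amalgamation

/-! ### Extracting a two-column array from a binary tree. -/

section Array

/-- In the binary tree, one finds, along a branch, pairs of nodes of equal colour, where
the first node of each pair lies on the branch and the second one is the sibling of one of its
initial segments. -/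
theorem exists_array_nodes {D : Type*} [Finite D]
    (color : ℕ → (ℕ → Bool → List Bool) → List Bool → D)
    (hcolor : ∀ i g g', (∀ j < i, g j = g' j) → color i g = color i g') (k : ℕ) :
    ∃ g : ℕ → Bool → List Bool,
      (∀ i < k, color i g (g i false) = color i g (g i true)) ∧
      (∀ i < k, ∃ η, g i true = η ++ [true] ∧ η ++ [false] <+: g i false) ∧
      (∀ i j, i < j → j < k → ∀ β, g i false <+: g j β) ∧
      ∃ ρ, ∀ i < k, g i false <+: ρ := by
  induction k with
  | zero => exact ⟨fun _ _ => [], by simp, by simp, by simp, [], by simp⟩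
  | succ k ih =>
    obtain ⟨g, h₁, h₂, h₃, ρ, hρ⟩ := ih
    -- These infinitely many nodes leave the all-`false` path above `ρ`; for `j < l`, `node j` is
    -- the `true` sibling of an initial segment of `node l`. Of two with equal colour, the longer
    -- continues the branch.
    let node : ℕ → List Bool := fun j => ρ ++ (List.replicate j false ++ [true])
    obtain ⟨j, l, hjl, heq⟩ : ∃ j l, j < l ∧ color k g (node j) = color k g (node l) := by
      obtain ⟨j, l, hne, heq⟩ := Finite.exists_ne_map_eq_of_infinite fun j => color k g (node j)
      rcases lt_or_gt_of_ne hne with h | h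
      · exact ⟨j, l, h, heq⟩
      · exact ⟨l, j, h, heq.symm⟩
    let g' := Function.update g k fun β => if β then node j else node l
    have hlt : ∀ i < k, g' i = g i := fun i hi => Function.update_of_ne hi.ne _ _
    have hk : g' k = fun β => if β then node j else node l := Function.update_self _ _ _
    refine ⟨g', fun i hi => ?_, fun i hi => ?_, fun i i' hii' hi' β => ?_, g' k false,
      fun i hi => ?_⟩
    · rw [hcolor i g' g fun j hj => hlt j (by omega)]
      rcases Nat.lt_succ_iff_lt_or_eq.1 hi with hi | rfl
      · rw [hlt i hi]
        exact h₁ i hi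
      · simpa [hk] using heq.symm
    · rcases Nat.lt_succ_iff_lt_or_eq.1 hi with hi | rfl
      · rw [hlt i hi]
        exact h₂ i hi
      · refine ⟨ρ ++ List.replicate j false, by simp [hk, node], ?_⟩
        obtain ⟨d, rfl⟩ := Nat.exists_eq_add_of_lt hjl
        simp only [hk, node, Bool.false_eq_true, if_false, List.append_assoc]
        refine (List.prefix_append_right_inj _).2 ?_
        rw [show j + d + 1 = j + (1 + d) by omega, List.replicate_add, List.append_assoc,
          List.replicate_add, List.append_assoc]
        refine (List.prefix_append_right_inj _).2 (List.prefix_append _ _)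
    · rcases Nat.lt_succ_iff_lt_or_eq.1 hi' with hi' | rfl
      · rw [hlt i (hii'.trans hi'), hlt i' hi']
        exact h₃ i i' hii' hi' β
      · rw [hlt i hii', hk]
        cases β <;> exact (hρ i hii').trans (List.prefix_append _ _)
    · rcases Nat.lt_succ_iff_lt_or_eq.1 hi with hi | rfl
      · rw [hlt i hi, hk]
        exact (hρ i hi).trans (List.prefix_append _ _)
      · exact List.prefix_rfl

end Array

/-! ### Arrays and Skolem terms over their entries. -/

section Skolem

variable {L : FirstOrder.Language.{u, v}}

/-- The variables standing for an array of pairs of `n`-tuples. -/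
abbrev ArrayVar (n : ℕ) : Type := (ℕ × Bool) × Fin n

/-- The variables of the rows of an array before row `i`. -/
abbrev ArrayVarBelow (n i : ℕ) : Type := {x : ArrayVar n // x.1.1 < i}

/-- A term mentions finitely many rows. Thus each element of the hull is a parameter from earlier
rows for all sufficiently late ones. -/
theorem exists_relabel_below {n : ℕ} (t : L.skolem₁.Term (ArrayVar n)) :
    ∃ J, ∀ j, J ≤ j → ∃ t' : L.skolem₁.Term (ArrayVarBelow n j), t'.relabel Subtype.val = t := by
  classical
  induction t with
  | var x => exact ⟨x.1.1 + 1, fun j hj => ⟨Term.var ⟨x, hj⟩, rfl⟩⟩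
  | func f ts ih =>
    choose J hJ using ih
    refine ⟨Finset.univ.sup J, fun j hj => ?_⟩
    choose t' ht' using fun i => hJ i j ((Finset.le_sup (Finset.mem_univ i)).trans hj)
    exact ⟨Term.func f t', by simp only [Term.relabel, ht']⟩

/-- A finite approximation of an array witnessing `SOP₁`. -/
structure IsApproxArray {K : Type*} [L.Structure K] [Nonempty K] {m n : ℕ}
    (φ : L.Formula (Fin m ⊕ Fin n)) (k : ℕ)
    (D : Finset (Σ i, L.Formula (Fin n ⊕ L.skolem₁.Term (ArrayVarBelow n i))))
    (c : ArrayVar n → K) : Prop where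
  equiv : ∀ d ∈ D, d.1 < k →
    (d.2.Realize (Sum.elim (fun l => c ((d.1, false), l))
        fun t => t.realize fun x : ArrayVarBelow n d.1 => c x) ↔
      d.2.Realize (Sum.elim (fun l => c ((d.1, true), l))
        fun t => t.realize fun x : ArrayVarBelow n d.1 => c x))
  consistent : ∃ x : Fin m → K, ∀ j < k, φ.Realize (Sum.elim x fun l => c ((j, false), l))
  inconsistent : ∀ i j, i < j → j < k → ¬ ∃ x : Fin m → K,
    φ.Realize (Sum.elim x fun l => c ((i, true), l)) ∧
      φ.Realize (Sum.elim x fun l => c ((j, true), l))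

theorem ExemplifiesSOP1.exists_isApproxArray {K : Type w} [L.Structure K] [Nonempty K] {m n : ℕ}
    {φ : L.Formula (Fin m ⊕ Fin n)} {a : List Bool → Fin n → K} (h : ExemplifiesSOP1 φ a) (k : ℕ)
    (D : Finset (Σ i, L.Formula (Fin n ⊕ L.skolem₁.Term (ArrayVarBelow n i)))) :
    ∃ c : ArrayVar n → K, IsApproxArray φ k D c := by
  classical
  -- The colour of a node at row `i` records which row-`i` formulas of `D` it satisfies over terms
  -- in the earlier rows. The conjunct `d.1.1 = i` makes it depend on those rows only.
  obtain ⟨g, h₁, h₂, h₃, ρ, hρ⟩ := exists_array_nodes (D := D → Prop)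
    (fun i g η d => d.1.1 = i ∧ d.1.2.Realize (Sum.elim (a η)
      fun t => t.realize fun x : ArrayVarBelow n d.1.1 => a (g x.1.1.1 x.1.1.2) x.1.2))
    (fun i g g' hgg => by
      funext η d
      refine propext (and_congr_right fun hd => ?_)
      have : (fun x : ArrayVarBelow n d.1.1 => a (g x.1.1.1 x.1.1.2) x.1.2) =
          fun x : ArrayVarBelow n d.1.1 => a (g' x.1.1.1 x.1.1.2) x.1.2 :=
        funext fun x => by rw [hgg x.1.1.1 (hd ▸ x.2)]
      rw [this]) k
  refine ⟨fun x => a (g x.1.1 x.1.2) x.2, ⟨fun d hd hdk => ?_, ?_, fun i j hij hj => ?_⟩⟩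
  · have := congrFun (h₁ d.1 hdk) ⟨d, hd⟩
    simpa using this
  -- Any infinite branch through `ρ` will do; the default `false` only prolongs it.
  · let η : ℕ → Bool := fun i => ρ.getD i false
    obtain ⟨x, hx⟩ := h.1 η ((Finset.range k).image fun i => a (g i false)) (by
      intro b hb
      obtain ⟨i, hi, rfl⟩ := Finset.mem_image.1 (Finset.mem_coe.1 hb)
      have hp := hρ i (Finset.mem_range.1 hi)
      refine ⟨(g i false).length, congrArg a ?_⟩
      refine List.ext_getElem (by simp) fun l hl hl' => ?_
      have := hp.getElem hl'
      simp [η, this, List.getElem?_eq_getElem (hl'.trans_le hp.length_le)])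
    exact ⟨x, fun j hj => hx _ (Finset.mem_image_of_mem _ (Finset.mem_range.2 hj))⟩
  · rintro ⟨x, hx₁, hx₂⟩
    obtain ⟨η, hη, hη'⟩ := h₂ i (hij.trans hj)
    refine h.2 η (g j true) (hη'.trans (h₃ i j hij hj true)) fun F hF => ⟨x, fun b hb => ?_⟩
    rcases hF hb with rfl | hb
    · rw [← hη]
      exact hx₁
    · rw [Set.mem_singleton_iff.1 hb]
      exact hx₂

/-- This is where `κ > |L|` enters: it makes the Skolem hull of the array small. -/
theorem mk_skolemTerm_lt {κ : Cardinal.{w}} (hκ : ℵ₀ < κ)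
    (hL : Cardinal.lift.{w} L.card < Cardinal.lift.{max u v} κ) (n : ℕ) :
    lift.{w} #(L.skolem₁.Term (ArrayVar n)) < lift.{max u v} κ := by
  have h₁ : #(Σ i, L.skolem₁.Functions i) ≤ max ℵ₀ L.card :=
    card_functions_sum_skolem₁.symm.le.trans card_functions_sum_skolem₁_le
  have h₂ : #(L.skolem₁.Term (ArrayVar n)) ≤ max ℵ₀ L.card := by
    refine Term.card_le.trans (max_le (le_max_left _ _) ?_)
    rw [mk_sum]
    refine (add_le_max _ _).trans (max_le (max_le ?_ ?_) (le_max_left _ _))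
    · exact le_max_of_le_left (lift_le_aleph0.2 mk_le_aleph0)
    · simpa using h₁
  refine (lift_le.2 h₂).trans_lt ?_
  rw [lift_max]
  exact max_lt (by simpa using hκ) hL

end Skolem

/-! ### Elementary substructures indexed by Skolem terms. -/

section SkolemHull

variable {L : FirstOrder.Language.{u, v}}

/-- A bounded formula with the last variable left free and terms substituted for the others. -/
noncomputable def substLast {V : Type*} {n : ℕ} (φ : L.BoundedFormula Empty (n + 1))
    (ts : Fin n → V) : L.Formula (Unit ⊕ V) :=
  Formula.relabel (Sum.elim Empty.elim (Fin.snoc (fun i => Sum.inr (ts i)) (Sum.inl ())))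
    φ.toFormula

theorem realize_substLast {V K : Type*} [L.Structure K] {n : ℕ}
    (φ : L.BoundedFormula Empty (n + 1)) (ts : Fin n → V) (x : Unit → K) (y : V → K) :
    (substLast φ ts).Realize (Sum.elim x y) ↔
      φ.Realize default (Fin.snoc (y ∘ ts) (x ()) : Fin (n + 1) → K) := by
  rw [substLast, Formula.realize_relabel, BoundedFormula.realize_toFormula]
  have : (Sum.elim x y ∘ Sum.elim Empty.elim
      (Fin.snoc (fun i => Sum.inr (ts i)) (Sum.inl ()))) ∘ Sum.inr =
        (Fin.snoc (y ∘ ts) (x ()) : Fin (n + 1) → K) := by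
    ext i
    refine Fin.lastCases ?_ (fun i => ?_) i <;> simp
  rw [this]
  exact iff_of_eq (congrArg (fun z => φ.Realize z _) (Subsingleton.elim _ _))

variable {K N : Type*} [L.Structure K] [Nonempty K] [L.Structure N] [Nonempty N] {X : Type*}
  {y : L.skolem₁.Term X → N}

/-- The monster carries no Skolem functions: `y` merely names elements by terms. The Skolem axiom
for `φ` holds of all term evaluations in `K`, so it holds of `y`, and this is the Tarski–Vaught
condition for the range of `y`. -/
theorem exists_term_of_realize
    (hy : ∀ ψ : L.Formula (L.skolem₁.Term X),
      (∀ c : X → K, ψ.Realize fun t => t.realize c) → ψ.Realize y)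
    {n : ℕ} (φ : L.BoundedFormula Empty (n + 1)) (ts : Fin n → L.skolem₁.Term X) {a : N}
    (ha : φ.Realize default (Fin.snoc (y ∘ ts) a : Fin (n + 1) → N)) :
    ∃ t, φ.Realize default (Fin.snoc (y ∘ ts) (y t) : Fin (n + 1) → N) := by
  let t : L.skolem₁.Term X := Term.func (φ : L.skolem₁.Functions n) ts
  have h := hy ((projection (substLast φ ts)).imp
    (Formula.relabel (Sum.elim (fun _ => t) id) (substLast φ ts))) fun c => by
      rw [Formula.realize_imp, realize_projection, Formula.realize_relabel]
      rintro ⟨x, hx⟩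
      rw [realize_substLast] at hx
      have : (fun t : L.skolem₁.Term X => t.realize c) ∘ Sum.elim (fun _ => t) id =
          Sum.elim (fun _ : Unit => t.realize c) fun t => t.realize c := by
        ext (i | i) <;> rfl
      rw [this, realize_substLast]
      exact Classical.epsilon_spec (p := fun b => φ.Realize default
        (Fin.snoc (fun i => (ts i).realize c) b : Fin (n + 1) → K)) ⟨_, hx⟩
  rw [Formula.realize_imp, realize_projection, Formula.realize_relabel] at h
  have h' := h ⟨fun _ => a, (realize_substLast _ _ _ _).2 ha⟩
  have : y ∘ Sum.elim (fun _ => t) id = Sum.elim (fun _ : Unit => y t) y := by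
    ext (i | i) <;> rfl
  rw [this, realize_substLast] at h'
  exact ⟨t, h'⟩

theorem exists_elementarySubstructure_range
    (hy : ∀ ψ : L.Formula (L.skolem₁.Term X),
      (∀ c : X → K, ψ.Realize fun t => t.realize c) → ψ.Realize y) :
    ∃ M : L.ElementarySubstructure N, (M : Set N) = Set.range y := by
  let S : L.Substructure N :=
    { carrier := Set.range y
      fun_mem := fun {n} f x hx => by
        choose ts hts using hx
        -- Closure under `f` is the instance of the witness property for the formula `f(x) = z`.
        obtain ⟨t, ht⟩ := exists_term_of_realize hy (n := n)
          (Term.bdEqual (Term.func f fun i => Term.var (Sum.inr (Fin.castSucc i)))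
            (Term.var (Sum.inr (Fin.last n)))) ts (a := Structure.funMap f x) (by
              simp only [BoundedFormula.realize_bdEqual, Term.realize_func, Term.realize_var,
                Sum.elim_inr, Fin.snoc_castSucc, Fin.snoc_last, Function.comp_apply, hts])
        refine ⟨t, ?_⟩
        simpa only [BoundedFormula.realize_bdEqual, Term.realize_func, Term.realize_var,
                Sum.elim_inr, Fin.snoc_castSucc, Fin.snoc_last, Function.comp_apply, hts]
          using ht.symm }
  refine ⟨⟨S, S.isElementary_of_exists fun n φ x a ha => ?_⟩, rfl⟩
  choose ts hts using fun i => (x i).2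
  have hx : (Subtype.val ∘ x : Fin n → N) = y ∘ ts := funext fun i => (hts i).symm
  have ha' : φ.Realize default (Fin.snoc (Subtype.val ∘ x : Fin n → N) a : Fin (n + 1) → N) := ha
  rw [hx] at ha'
  obtain ⟨t, ht⟩ := exists_term_of_realize hy φ ts ha'
  rw [← hx] at ht
  exact ⟨⟨y t, t, rfl⟩, ht⟩

end SkolemHull

/-! ### Moving arrays into the monster. -/

section Transfer

variable {L : FirstOrder.Language.{u, v}} {T : L.Theory} {N : Type w} [L.Structure N]
  [Nonempty N] [N ⊨ T] {κ : Cardinal.{w}}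

/-- Arrays with arbitrarily good finite approximations in one model of a complete theory are
realized, with a Skolem hull, in a saturated model. -/
theorem exists_skolem_array (hT : T.IsComplete) (hN : IsMonster L N κ) {K : Type w'}
    [L.Structure K] [Nonempty K] [K ⊨ T] {m n : ℕ} (φ : L.Formula (Fin m ⊕ Fin n))
    (h : ∀ k D, ∃ c : ArrayVar n → K, IsApproxArray φ k D c) :
    ∃ y : L.skolem₁.Term (ArrayVar n) → N,
      ∀ ψ : L.Formula (L.skolem₁.Term (ArrayVar n)),
        (∃ k D, ∀ c : ArrayVar n → K, IsApproxArray φ k D c → ψ.Realize fun t => t.realize c) →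
          ψ.Realize y := by
  classical
  have hy : ∀ (S : Type _) (e : L.skolem₁.Term (ArrayVar n) → S),
      Sum.elim e (Empty.elim : Empty → S) ∘ Sum.inl = e := fun S e => Sum.elim_comp_inl _ _
  obtain ⟨y, h⟩ := hN.saturated.exists_realize hN.aleph0_lt.le (Y := Empty)
    (mk_skolemTerm_lt hN.aleph0_lt hN.card_lt n)
    (by simpa using hN.aleph0_lt.bot_lt) (Empty.elim : Empty → N)
    {θ | ∃ ψ : L.Formula (L.skolem₁.Term (ArrayVar n)), θ = Formula.relabel Sum.inl ψ ∧
      ∃ k D, ∀ c : ArrayVar n → K, IsApproxArray φ k D c → ψ.Realize fun t => t.realize c} (by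
    intro Δ hΔ
    have hΔ' : ∀ θ ∈ Δ, ∃ (ψ : L.Formula (L.skolem₁.Term (ArrayVar n))) (k : ℕ)
        (D : Finset (Σ i, L.Formula (Fin n ⊕ L.skolem₁.Term (ArrayVarBelow n i)))),
        θ = Formula.relabel Sum.inl ψ ∧
        ∀ c : ArrayVar n → K, IsApproxArray φ k D c → ψ.Realize fun t => t.realize c :=
      fun θ hθ => by
        obtain ⟨ψ, h₁, k, D, h₂⟩ := hΔ hθ
        exact ⟨ψ, k, D, h₁, h₂⟩
    choose! ψ k D h₁ h₂ using hΔ'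
    obtain ⟨c, hc⟩ := h (Δ.sup k) (Δ.biUnion D)
    have hcθ : ∀ θ ∈ Δ, IsApproxArray φ (k θ) (D θ) c := fun θ hθ =>
      ⟨fun d hd hdk => hc.equiv d (Finset.mem_biUnion.2 ⟨θ, hθ, hd⟩)
          (hdk.trans_le (Finset.le_sup hθ)),
        hc.consistent.imp fun x hx j hj => hx j (hj.trans_le (Finset.le_sup hθ)),
        fun i j hij hj => hc.inconsistent i j hij (hj.trans_le (Finset.le_sup hθ))⟩
    -- Completeness of `T` transfers a finite part of the requirements from `K` to `N`; saturation
    -- then collects them.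
    obtain ⟨y, hy'⟩ := exists_realize_of_isComplete hT (N := N)
      (Formula.iInf fun θ : Δ => ψ θ) (x := fun t => t.realize c)
      (Formula.realize_iInf.2 fun θ => h₂ θ θ.2 c (hcθ θ θ.2))
    refine ⟨y, fun θ hθ => ?_⟩
    rw [h₁ θ hθ, Formula.realize_relabel, hy]
    exact Formula.realize_iInf.1 hy' ⟨θ, hθ⟩)
  refine ⟨y, fun ψ hψ => ?_⟩
  have := h _ ⟨ψ, rfl, hψ⟩
  rwa [Formula.realize_relabel, hy] at this

end Transfer

/-! ### SOP₁ arrays inside a small model. -/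

section ModelArray

theorem realize_relabel_right {L : FirstOrder.Language.{u, v}} {K : Type w} [L.Structure K]
    {X Y Z : Type*} (φ : L.Formula (X ⊕ Y)) (f : Y → Z) (x : X → K) (e : Z → K) :
    (Formula.relabel (Sum.map id f) φ).Realize (Sum.elim x e) ↔
      φ.Realize (Sum.elim x (e ∘ f)) := by
  rw [Formula.realize_relabel, Sum.elim_comp_map, Function.comp_id]

variable {L : FirstOrder.Language.{u, v}} {T : L.Theory} {N : Type w} [L.Structure N]
  [Nonempty N] [N ⊨ T] {κ : Cardinal.{w}}

/-- An array in `M` whose two columns have eventually the same formulas over `M`; the formula `φ`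
is consistent along the first column and inconsistent along the second one. -/
structure IsSOP1Array {m n : ℕ} (φ : L.Formula (Fin m ⊕ Fin n)) (M : Set N)
    (A : Bool → ℕ → Fin n → N) : Prop where
  mem : ∀ β i l, A β i l ∈ M
  eventually : ∀ χ : L.Formula (Fin n ⊕ M), ∀ᶠ i in Filter.atTop,
    (χ.Realize (Sum.elim (A false i) Subtype.val) ↔ χ.Realize (Sum.elim (A true i) Subtype.val))
  consistent : ∀ k : ℕ, ∃ x : Fin m → N, ∀ j < k, φ.Realize (Sum.elim x (A false j))
  inconsistent : ∀ i j, i < j → ¬ ∃ x : Fin m → N,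
    φ.Realize (Sum.elim x (A true i)) ∧ φ.Realize (Sum.elim x (A true j))

theorem HasSOP1.exists_isSOP1Array (hT : T.IsComplete) (hN : IsMonster L N κ)
    (h : HasSOP1 T) : ∃ (m n : ℕ) (φ : L.Formula (Fin m ⊕ Fin n)) (M : L.ElementarySubstructure N)
      (A : Bool → ℕ → Fin n → N), #M < κ ∧ IsSOP1Array φ (M : Set N) A := by
  classical
  obtain ⟨K, m, n, φ, a, ha⟩ := h
  obtain ⟨y, hy⟩ := exists_skolem_array hT hN (K := K) φ fun k D => ha.exists_isApproxArray k D
  obtain ⟨M, hM⟩ := exists_elementarySubstructure_range (K := K) (y := y) fun ψ hψ =>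
    hy ψ ⟨0, ∅, fun c _ => hψ c⟩
  let V := L.skolem₁.Term (ArrayVar n)
  let q : ℕ → Bool → Fin n → V := fun i β l => Term.var ((i, β), l)
  let at₁ : ℕ → Bool → L.Formula (Fin m ⊕ V) := fun i β => Formula.relabel (Sum.map id (q i β)) φ
  refine ⟨m, n, φ, M, fun β i l => y (q i β l), ?_, ⟨fun β i l => ?_, fun χ => ?_, fun k => ?_,
    fun i j hij => ?_⟩⟩
  · rw [← lift_lt.{w, max u v}]
    have : #M = #(Set.range y) := congrArg (fun s : Set N => #s) hM
    rw [this]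
    exact mk_range_le_lift.trans_lt (mk_skolemTerm_lt hN.aleph0_lt hN.card_lt n)
  · rw [hM]
    exact ⟨_, rfl⟩
  · obtain ⟨r, t, θ, hθ, -⟩ := exists_finite_right_support.{u, v, w, w} χ
    have ht : ∀ i, ∃ s, y s = t i := fun i => (Set.ext_iff.1 hM _).1 (t i).2
    choose ts hts using ht
    choose J hJ using fun i => exists_relabel_below (ts i)
    -- Beyond this row, the parameters of `χ` are named by terms in rows below `i`, so the agreement
    -- built into the approximations applies to `χ`.
    refine Filter.eventually_atTop.2 ⟨Finset.univ.sup J, fun i hi => ?_⟩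
    choose ts' hts' using fun k => hJ k i ((Finset.le_sup (Finset.mem_univ k)).trans hi)
    let θ' : L.Formula (Fin n ⊕ L.skolem₁.Term (ArrayVarBelow n i)) :=
      Formula.relabel (Sum.map id ts') θ
    let p : Bool → Fin n ⊕ L.skolem₁.Term (ArrayVarBelow n i) → V := fun β =>
      Sum.elim (q i β) (Term.relabel Subtype.val)
    have h := hy ((Formula.relabel (p false) θ').iff (Formula.relabel (p true) θ'))
      ⟨i + 1, {⟨i, θ'⟩}, fun c hc => by
        have := hc.equiv ⟨i, θ'⟩ (Finset.mem_singleton_self _) (Nat.lt_succ_self i)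
        have hc' : ∀ β, (fun t : V => t.realize c) ∘ p β = Sum.elim (fun l => c ((i, β), l))
            fun t => t.realize fun x : ArrayVarBelow n i => c x := by
          intro β
          ext (l | l)
          · rfl
          · exact Term.realize_relabel
        rw [Formula.realize_iff, Formula.realize_relabel (g := p false),
          Formula.realize_relabel (g := p true), hc', hc']
        exact this⟩
    rw [Formula.realize_iff] at h
    have hp : ∀ β, (Formula.relabel (p β) θ').Realize y ↔
        χ.Realize (Sum.elim (fun l => y (q i β l)) Subtype.val) := by
      intro β
      rw [← hθ, Formula.realize_relabel, Formula.realize_relabel]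
      have : (y ∘ p β) ∘ Sum.map id ts' =
          Sum.elim (fun l => y (q i β l)) ((fun k : ((M : Set N) : Type w) => (k : N)) ∘ t) := by
        ext (l | l)
        · rfl
        · exact (congrArg y (hts' l)).trans (hts l)
      rw [this]
    rwa [hp, hp] at h
  · have h := hy (projection (Formula.iInf fun j : Fin k => at₁ j false)) ⟨k, ∅, fun c hc => by
      obtain ⟨x, hx⟩ := hc.consistent
      exact (realize_projection _ _).2 ⟨x, Formula.realize_iInf.2 fun j => (realize_relabel_right _ _ _ _).2
        (hx j j.2)⟩⟩
    obtain ⟨x, hx⟩ := (realize_projection _ _).1 h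
    exact ⟨x, fun j hj => (realize_relabel_right _ _ _ _).1 (Formula.realize_iInf.1 hx ⟨j, hj⟩)⟩
  · rintro ⟨x, hx₁, hx₂⟩
    have h := hy (projection (at₁ i true ⊓ at₁ j true)).not ⟨j + 1, ∅, fun c hc => by
      rw [Formula.realize_not]
      intro hx
      obtain ⟨x, hx⟩ := (realize_projection _ _).1 hx
      rw [Formula.realize_inf, realize_relabel_right, realize_relabel_right] at hx
      exact hc.inconsistent i j hij (Nat.lt_succ_self j) ⟨x, hx⟩⟩
    refine Formula.realize_not.1 h ((realize_projection _ _).2 ⟨x, ?_⟩)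
    rw [Formula.realize_inf, realize_relabel_right, realize_relabel_right]
    exact ⟨hx₁, hx₂⟩

end ModelArray

/-! ### Limits of sequences of tuples along an ultrafilter. -/

section Limit

variable {L : FirstOrder.Language.{u, v}} {N : Type w} [L.Structure N]

/-- Over the parameters `y`, the tuple `e` realizes the limit of the types of the tuples `a i`
along the ultrafilter `U`. -/
def RealizesLimit (L : FirstOrder.Language.{u, v}) {N : Type w} [L.Structure N]
    (U : Ultrafilter ℕ) {ι Y : Type*} (a : ℕ → ι → N) (y : Y → N)
    (e : ι → N) : Prop :=
  ∀ χ : L.Formula (ι ⊕ Y), χ.Realize (Sum.elim e y) ↔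
    ∀ᶠ i in (U : Filter ℕ), χ.Realize (Sum.elim (a i) y)

variable {U : Ultrafilter ℕ} {ι Y Z : Type*} {a : ℕ → ι → N} {y : Y → N} {e : ι → N}

theorem RealizesLimit.comp (h : RealizesLimit L U a y e) (f : Z → Y) :
    RealizesLimit L U a (y ∘ f) e := fun χ => by
  have := h (Formula.relabel (Sum.map id f) χ)
  simpa only [Formula.realize_relabel, Sum.elim_comp_map, Function.comp_id] using this

theorem RealizesLimit.map (h : RealizesLimit L U a y e) (σ : N ≃[L] N)
    (hσ : ∀ i, σ ∘ a i = a i) : RealizesLimit L U a (σ ∘ y) (σ ∘ e) := fun χ => by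
  have key : ∀ e' : ι → N, χ.Realize (Sum.elim (σ ∘ e') (σ ∘ y)) ↔
      χ.Realize (Sum.elim e' y) := fun e' => by
    rw [← Sum.comp_elim]
    exact SameType.of_equiv σ _ χ
  rw [key, h χ]
  refine Filter.eventually_congr (Filter.Eventually.of_forall fun i => ?_)
  rw [← key, hσ]

theorem IsSaturated.exists_realizesLimit [Nonempty N] {κ : Cardinal.{w}}
    (hN : IsSaturated L N κ) (hκ : ℵ₀ ≤ κ) {ι Y : Type w} (hι : #ι < κ) (hY : #Y < κ)
    (U : Ultrafilter ℕ) (a : ℕ → ι → N) (y : Y → N) : ∃ e, RealizesLimit L U a y e := by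
  obtain ⟨e, he⟩ := hN.exists_realize hκ (lift_lt.2 hι) (lift_lt.2 hY) y
    {χ : L.Formula (ι ⊕ Y) | ∀ᶠ i in (U : Filter ℕ), χ.Realize (Sum.elim (a i) y)} fun Δ hΔ => by
      obtain ⟨i, hi⟩ := ((Filter.eventually_all_finset Δ).2 fun χ hχ => hΔ hχ).exists
      exact ⟨a i, hi⟩
  refine ⟨e, fun χ => ⟨fun h => ?_, fun h => he χ h⟩⟩
  by_contra hn
  have hn' : ∀ᶠ i in (U : Filter ℕ), χ.not.Realize (Sum.elim (a i) y) := by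
    simpa only [Formula.realize_not] using Ultrafilter.eventually_not.2 hn
  exact Formula.realize_not.1 (he χ.not hn') h

/-- A formula true of the limit is true of some `a i`, which lies in `M`. -/
theorem RealizesLimit.indU {M : Set N} (h : RealizesLimit L U a
    (Sum.elim (Subtype.val : M → N) y) e) (ha : ∀ i k, a i k ∈ M) :
    IndU L (Set.range e) M (Set.range y) := by
  intro ψ hψ
  choose s hs using fun x : Set.range e => x.2
  have hp : ∀ x : (Set.range y ∪ M : Set N), ∃ p : M ⊕ Y,
      Sum.elim (Subtype.val : M → N) y p = x := by
    rintro ⟨x, ⟨j, rfl⟩ | hx⟩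
    · exact ⟨Sum.inr j, rfl⟩
    · exact ⟨Sum.inl ⟨x, hx⟩, rfl⟩
  choose p hp using hp
  let χ : L.Formula (ι ⊕ (M ⊕ Y)) := Formula.relabel (Sum.elim (Sum.inr ∘ p) (Sum.inl ∘ s))
    (BoundedFormula.constantsVarsEquiv ψ : L.Formula ((Set.range y ∪ M : Set N) ⊕ Set.range e))
  have hχ : ∀ e' : ι → N, χ.Realize (Sum.elim e' (Sum.elim Subtype.val y)) ↔
      ψ.Realize (e' ∘ s) := by
    intro e'
    rw [Formula.realize_relabel, ← realize_constantsVarsEquiv_val]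
    rw [show Sum.elim e' (Sum.elim (Subtype.val : M → N) y) ∘
      Sum.elim (Sum.inr ∘ p) (Sum.inl ∘ s) = Sum.elim Subtype.val (e' ∘ s) by
        ext (i | i)
        · exact hp i
        · rfl]
  have hes : e ∘ s = fun x : Set.range e => (x : N) := funext hs
  obtain ⟨i, hi⟩ := ((h χ).1 ((hχ e).2 (hes ▸ hψ))).exists
  exact ⟨a i ∘ s, fun x => ha i _, (hχ _).1 hi⟩

end Limit

/-! ### SOP₁ refutes amalgamation for `IndH`. -/

section Failure

variable {L : FirstOrder.Language.{u, v}} {T : L.Theory} {N : Type w} [L.Structure N]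
  {κ : Cardinal.{w}}

/-- A realization of a limit of tuples from `M` over `M` and `y` can be moved to any tuple of the
same type over `M`, moving `y` along. -/
theorem RealizesLimit.exists_conjugate (hN : IsMonster L N κ) {M : Set N} (hM : #M < κ)
    {ι Y : Type w} (hι : #ι < κ) {U : Ultrafilter ℕ} {a : ℕ → ι → N} (ha : ∀ i k, a i k ∈ M)
    {y : Y → N} {e e' : ι → N} (he : RealizesLimit L U a (Sum.elim (Subtype.val : M → N) y) e)
    (hee : SameType L (Sum.elim (Subtype.val : M → N) e) (Sum.elim (Subtype.val : M → N) e')) :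
    ∃ y' : Y → N, RealizesLimit L U a (Sum.elim (Subtype.val : M → N) y') e' ∧
      SameType L (Sum.elim (Subtype.val : M → N) (Sum.elim y' e'))
        (Sum.elim (Subtype.val : M → N) (Sum.elim y e)) := by
  obtain ⟨σ, hσ⟩ := hN.homogeneous.exists_equiv (mk_sum_lt hN.aleph0_lt.le hM hι) hee
  have hσM : ∀ m : M, σ m = m := fun m => congrFun hσ (Sum.inl m)
  have hσe : σ ∘ e = e' := funext fun i => congrFun hσ (Sum.inr i)
  refine ⟨σ ∘ y, ?_, ?_⟩
  · have := he.map σ fun i => funext fun k => hσM ⟨_, ha i k⟩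
    rw [hσe] at this
    convert this using 1
    ext (m | j)
    · exact (hσM m).symm
    · rfl
  · convert SameType.of_equiv σ (Sum.elim (Subtype.val : M → N) (Sum.elim y e)) using 1
    ext (m | j | i)
    · exact (hσM m).symm
    · rfl
    · exact (congrFun hσe i).symm

variable [Nonempty N]

theorem IsSOP1Array.not_weakIndependentAmalgamation (hN : IsMonster L N κ) {m n : ℕ}
    {φ : L.Formula (Fin m ⊕ Fin n)} {M : L.ElementarySubstructure N} (hM : #M < κ)
    {A : Bool → ℕ → Fin n → N} (hA : IsSOP1Array φ (M : Set N) A) :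
    ¬ WeakIndependentAmalgamation L κ (IndH L (N := N)) := by
  intro hW
  have hκ := hN.aleph0_lt.le
  let S : Set N := M
  have hS : #S < κ := hM
  have hfin : ∀ k : ℕ, #(ULift.{w} (Fin k)) < κ := fun k =>
    (lt_aleph0_of_finite _).trans hN.aleph0_lt
  let U : Ultrafilter ℕ := Filter.hyperfilter ℕ
  have hU : (U : Filter ℕ) ≤ Filter.atTop := Nat.hyperfilter_le_atTop
  let B : Bool → ℕ → ULift.{w} (Fin n) → N := fun β i => A β i ∘ ULift.down
  have hB : ∀ β i k, B β i k ∈ S := fun β i k => hA.mem β i _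
  let φ' : L.Formula (ULift.{w} (Fin m) ⊕ ULift.{w} (Fin n)) :=
    Formula.relabel (Sum.map ULift.up ULift.up) φ
  have hφ' : ∀ (x : ULift.{w} (Fin m) → N) (c : ULift.{w} (Fin n) → N),
      φ'.Realize (Sum.elim x c) ↔ φ.Realize (Sum.elim (x ∘ ULift.up) (c ∘ ULift.up)) := by
    intro x c
    rw [Formula.realize_relabel, Sum.elim_comp_map]
  obtain ⟨b, hb⟩ : ∃ b : ULift.{w} (Fin m) → N, ∀ i, φ'.Realize (Sum.elim b (B false i)) := by
    classical
    let p : ℕ → L.Formula (ULift.{w} (Fin m) ⊕ (ℕ × ULift.{w} (Fin n))) := fun i =>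
      Formula.relabel (Sum.map id fun k => (i, k)) φ'
    have hp : ∀ i (x : ULift.{w} (Fin m) → N),
        (p i).Realize (Sum.elim x fun q : ℕ × ULift.{w} (Fin n) => B false q.1 q.2) ↔
          φ'.Realize (Sum.elim x (B false i)) := by
      intro i x
      rw [Formula.realize_relabel, Sum.elim_comp_map]
      rfl
    obtain ⟨b, hb⟩ := hN.saturated.exists_realize hκ (lift_lt.2 (hfin m))
      (lift_lt.2 (mk_countable_prod_lt hN.aleph0_lt (hfin n)))
      (fun q : ℕ × ULift.{w} (Fin n) => B false q.1 q.2) (Set.range p) (by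
        intro Δ hΔ
        choose! k hk using fun θ (hθ : θ ∈ Δ) => hΔ hθ
        obtain ⟨x, hx⟩ := hA.consistent (Δ.sup k + 1)
        refine ⟨x ∘ ULift.down, fun θ hθ => ?_⟩
        rw [← hk θ hθ, hp, hφ']
        exact hx _ (Nat.lt_succ_of_le (Finset.le_sup hθ)))
    exact ⟨b, fun i => (hp i b).1 (hb _ ⟨i, rfl⟩)⟩
  have hBeq : ∀ χ : L.Formula (ULift.{w} (Fin n) ⊕ S), ∀ᶠ i in (U : Filter ℕ),
      (χ.Realize (Sum.elim (B false i) Subtype.val) ↔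
        χ.Realize (Sum.elim (B true i) Subtype.val)) := by
    intro χ
    filter_upwards [hU (hA.eventually (Formula.relabel (Sum.map ULift.down id) χ))] with i hi
    simpa only [Formula.realize_relabel, Sum.elim_comp_map, Function.comp_id] using hi
  -- `c'` is a limit of the consistent column over `Mb`, while `c₀` and then `c₁` over `Mc₀` are
  -- limits of the inconsistent one. By `hBeq` all three have the same type over `M`, so `bc'` can
  -- be conjugated to `b₀c₀` and to `b₁c₁`.
  obtain ⟨c', hc'⟩ := hN.saturated.exists_realizesLimit hκ (hfin n) (mk_sum_lt hκ hS (hfin m))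
    U (B false) (Sum.elim (Subtype.val : S → N) b)
  obtain ⟨c₀, hc₀⟩ := hN.saturated.exists_realizesLimit hκ (hfin n) hS
    U (B true) (Subtype.val : S → N)
  obtain ⟨c₁, hc₁⟩ := hN.saturated.exists_realizesLimit hκ (hfin n) (mk_sum_lt hκ hS (hfin n))
    U (B true) (Sum.elim (Subtype.val : S → N) c₀)
  have hswap : ∀ {c d : ULift.{w} (Fin n) → N},
      SameType L (Sum.elim c (Subtype.val : S → N)) (Sum.elim d (Subtype.val : S → N)) →
        SameType L (Sum.elim (Subtype.val : S → N) c) (Sum.elim (Subtype.val : S → N) d) := by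
    intro c d h
    convert h.comp Sum.swap using 1 <;> ext (i | i) <;> rfl
  have hcc₀ : SameType L (Sum.elim (Subtype.val : S → N) c')
      (Sum.elim (Subtype.val : S → N) c₀) := hswap fun χ =>
    (hc'.comp Sum.inl χ).trans ((Filter.eventually_congr (hBeq χ)).trans (hc₀ χ).symm)
  have hcc₁ : SameType L (Sum.elim (Subtype.val : S → N) c')
      (Sum.elim (Subtype.val : S → N) c₁) := hcc₀.trans (hswap fun χ =>
    (hc₀ χ).trans (hc₁.comp Sum.inl χ).symm)
  obtain ⟨b₀, hb₀, hbc₀⟩ := hc'.exists_conjugate hN hS (hfin n) (hB false) hcc₀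
  obtain ⟨b₁, hb₁, hbc₁⟩ := hc'.exists_conjugate hN hS (hfin n) (hB false) hcc₁
  obtain ⟨d, hd₁, hd₂⟩ := hW M hM _ _ (hfin m) (hfin n) b₀ b₁ c₀ c₁
    ((typeEq_iff_sameType _ _ _).2 (hbc₀.trans hbc₁.symm)) (hb₀.indU (hB false))
    (hb₁.indU (hB false)) (hc₁.indU (hB true))
  have hd₁' := ((typeEq_iff_sameType _ _ _).1 hd₁).comp Sum.inr
  have hd₂' := ((typeEq_iff_sameType _ _ _).1 hd₂).comp Sum.inr
  rw [Sum.elim_comp_inr, Sum.elim_comp_inr] at hd₁' hd₂'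
  have hbc₀' := hbc₀.comp Sum.inr
  rw [Sum.elim_comp_inr, Sum.elim_comp_inr] at hbc₀'
  have hφb : φ'.Realize (Sum.elim b c') := by
    have := (hc' (Formula.relabel (Sum.elim (Sum.inr ∘ Sum.inr) Sum.inl) φ')).2
      (Filter.Eventually.of_forall fun i => by
        rw [Formula.realize_relabel]
        convert hb i using 1
        ext (j | j) <;> rfl)
    rw [Formula.realize_relabel] at this
    convert this using 1
    ext (j | j) <;> rfl
  have hφ₁ : φ'.Realize (Sum.elim d c₁) := (hd₂' φ').2 ((hbc₀' φ').2 hφb)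
  have hφ₀ : φ'.Realize (Sum.elim d c₀) := (hd₁' φ').2 hφ₁
  let inc : L.Formula (ULift.{w} (Fin n) ⊕ ULift.{w} (Fin n)) :=
    (projection (Formula.relabel (Sum.map id Sum.inl) φ' ⊓
      Formula.relabel (Sum.map id Sum.inr) φ')).not
  have hinc : ∀ c e : ULift.{w} (Fin n) → N, inc.Realize (Sum.elim c e) ↔
      ¬ ∃ x : ULift.{w} (Fin m) → N, φ'.Realize (Sum.elim x c) ∧ φ'.Realize (Sum.elim x e) := by
    intro c e
    simp only [inc, Formula.realize_not, realize_projection, Formula.realize_inf,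
      Formula.realize_relabel, Sum.elim_comp_map, Function.comp_id, Sum.elim_comp_inl,
      Sum.elim_comp_inr]
  -- Pairwise inconsistency passes to the limit twice: first a fixed row against later ones gives
  -- row against `c₀`, then all rows against `c₀` give `c₁` against `c₀`.
  have h₀ : ∀ i, inc.Realize (Sum.elim c₀ (B true i)) := by
    intro i
    have := (hc₀ (Formula.relabel (Sum.map id fun k => (⟨B true i k, hB true i k⟩ : S)) inc)).2 (by
      filter_upwards [hU (Filter.eventually_gt_atTop i)] with j hj
      rw [Formula.realize_relabel, Sum.elim_comp_map]
      refine (hinc _ _).2 ?_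
      rintro ⟨x, hx₁, hx₂⟩
      exact hA.inconsistent i j hj ⟨x ∘ ULift.up, (hφ' _ _).1 hx₂, (hφ' _ _).1 hx₁⟩)
    rw [Formula.realize_relabel, Sum.elim_comp_map] at this
    exact this
  have h₁ := (hc₁ (Formula.relabel (Sum.map id Sum.inr) inc)).2
    (Filter.Eventually.of_forall fun i => by
      rw [Formula.realize_relabel, Sum.elim_comp_map, Sum.elim_comp_inr]
      refine (hinc _ _).2 ?_
      rintro ⟨x, hx₁, hx₂⟩
      exact (hinc _ _).1 (h₀ i) ⟨x, hx₂, hx₁⟩)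
  rw [Formula.realize_relabel, Sum.elim_comp_map, Sum.elim_comp_inr] at h₁
  exact (hinc _ _).1 h₁ ⟨d, hφ₁, hφ₀⟩

theorem isNSOP1_of_weakIndependentAmalgamation_indH [N ⊨ T] (hT : T.IsComplete)
    (hN : IsMonster L N κ) (h : WeakIndependentAmalgamation L κ (IndH L (N := N))) : IsNSOP1 T := by
  intro hS
  obtain ⟨m, n, φ, M, A, hM, hA⟩ := hS.exists_isSOP1Array hT hN
  exact hA.not_weakIndependentAmalgamation hN hM h

end Failure

end ModelTheoreticIndependence

theorem mainTheorem4 (L : FirstOrder.Language.{u, v}) (T : L.Theory) (hT : T.IsComplete)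
    (N : Type w) [L.Structure N] [Nonempty N] [N ⊨ T]
    (κ : Cardinal.{w}) (hN : ModelTheoreticIndependence.IsMonster L N κ) :
    List.TFAE
      [ModelTheoreticIndependence.WeakIndependentAmalgamation L κ
          (ModelTheoreticIndependence.IndCI L κ (N := N)),
        ModelTheoreticIndependence.WeakIndependentAmalgamation L κ
          (ModelTheoreticIndependence.IndH L (N := N)),
        ModelTheoreticIndependence.IsNSOP1 T] := by
  tfae_have 1 → 2 := ModelTheoreticIndependence.weakIndependentAmalgamation_indH_of_indCI
  tfae_have 2 → 3 :=
    ModelTheoreticIndependence.isNSOP1_of_weakIndependentAmalgamation_indH hT hN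
  tfae_have 3 → 1 :=
    ModelTheoreticIndependence.weakIndependentAmalgamation_indCI_of_isNSOP1 hN
  tfae_finish
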